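/- **Conventions.** Let $\mathbb K\in\{\mathbb R,\mathbb C\}$, $d\ge 0$, and let $A$ be either the algebra $C^\infty(\mathbb R^d,\mathbb K)$ or the algebra $\mathbb K[[x_1,\dots,x_d]]$ of functions on the formal completion of $\mathbb R^d$ at the origin. Let $C_n(A)=A\otimes\bar A^{\otimes n}$, $\bar A=A/\mathbb K1$, be the normalized Hochschild chains, with completed tensor products (so $C_n(A)$ is the space of functions, smooth resp. formal, on $(\mathbb R^d)^{n+1}$, in variables $x_0,\dots,x_n\in\mathbb R^d$, modulo sums of functions each independent of one of $x_1,\dots,x_n$), with Connes' operator $$B(a_0\otimes\dots\otimes a_n)=\sum_{j=0}^n(-1)^{nj}\,1\otimes a_j\otimes\dots\otimes a_n\otimes a_0\otimes\dots\otimes a_{j-1}.$$ Let $\Omega^\bullet$ be the differential forms with coefficients in $A$ and $d$ the de Rham differential. **Graphs.** For $m,n\ge 0$ let $G(m,n)$ be the set of directed graphs $\Gamma$ without multiple edges, with type I vertices $0,1,\dots,m$ ($0$ is called central) and type II vertices $\bar 0,\dots,\bar n$, such that every edge starts at a type I vertex, no edge ends at $0$, there are no edges $(v\to v)$, and for every type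 I vertex $v$ the set $\mathrm{Star}(v)$ of edges starting at $v$ is totally ordered. **Weights.** Let $C_\Gamma$ be the space of $z_0=0$, of distinct points $z_1,\dots,z_m\neq 0$ of the open unit disk, and of $z_{\bar 0}=1,z_{\bar1},\dots,z_{\bar n}$ on the unit circle with $0<\arg z_{\bar1}<\dots<\arg z_{\bar n}<2\pi$, oriented by the coordinates $(\operatorname{Re}z_1,\operatorname{Im}z_1,\dots,\operatorname{Re}z_m,\operatorname{Im}z_m,\arg z_{\bar1},\dots,\arg z_{\bar n})$. Put $$d\theta_c(z,w)=\tfrac1{2\pi}\,d\arg\tfrac zw,\qquad d\theta(z,w)=\tfrac1{2\pi}\,d\arg\big((z-w)(1-z\bar w)\bar z\big),$$ $$w_\Gamma=\prod_{v}\frac1{(\#\mathrm{Star}(v))!}\int_{C_\Gamma}\ \bigwedge_{(0\to K)}d\theta_c(z_K,z_{\bar0})\wedge\bigwedge_{j=1}^m\ \bigwedge_{(j\to L)}d\theta(z_j,z_L),$$ where the factors belonging to one vertex are ordered as in its star, and where $w_\Gamma=0$ unless the number of edges is $2m+n=\dim C_\Gamma$. **The morphism.** For polyvector fields $\gamma_1,\dots,\gamma_m$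 with coefficients in $A$, $\gamma_j$ of degree $k_j$ (a section of $\bigwedge^{k_j}$ of the tangent bundle), define $U_m(\gamma_1\wedge\dots\wedge\gamma_m;a_0\otimes\dots\otimes a_n)\in\Omega^\bullet$ by its values on constant polyvector fields $\xi=v_1\wedge\dots\wedge v_p$ ($p\ge0$): $$U_m(\gamma_1\wedge\dots\wedge\gamma_m;a_0\otimes\dots\otimes a_n)[\xi]=\sum_\Gamma w_\Gamma\,D_\Gamma(\xi,\gamma_1\wedge\dots\wedge\gamma_m;a_0,\dots,a_n),$$ the sum being over the $\Gamma\in G(m,n)$ with $\#\mathrm{Star}(0)=p$ and $\#\mathrm{Star}(j)=k_j$ for $1\le j\le m$. Here $$D_\Gamma=\sum_{I}\ \xi^{I|_{\mathrm{Star}(0)}}\ \prod_{j=1}^m\Big(\prod_{e=(\cdot\to j)}\partial_{I(e)}\Big)\gamma_j^{I|_{\mathrm{Star}(j)}}\ \prod_{l=0}^n\Big(\prod_{e=(\cdot\to\bar l)}\partial_{I(e)}\Big)a_l ,$$ where $I$ runs over all maps from the edges to $\{1,\dots,d\}$ and upper indices denote the components of the antisymmetric tensor of a polyvector field ($v_1\wedge\dots\wedge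 v_p$ has the components $\det(v_a^{i_b})_{a,b}$). The operator extends to the completed tensor product and vanishes on degenerate chains, so $U_m(\gamma_1\wedge\dots\wedge\gamma_m;\cdot):C_n(A)\to\Omega^\bullet$ is well defined. The $U_m$ are the Taylor components of Shoikhet's morphism $U^{sh}$. **Theorem.** $U^{sh}\circ B=d\circ U^{sh}$. That is, for all $m,n\ge0$, all homogeneous polyvector fields $\gamma_1,\dots,\gamma_m$ and all $c\in C_n(A)$, $$U_m(\gamma_1\wedge\dots\wedge\gamma_m;Bc)=d\,U_m(\gamma_1\wedge\dots\wedge\gamma_m;c),$$ an identity of differential forms in all degrees (in degree $0$ it says that the function component of the left side is $0$). -/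

import Mathlib

noncomputable section

namespace Shoikhet

open scoped ContDiff ComplexConjugate

universe u

/-! ## Functions of finitely many coordinates

Smooth functions and formal power series are treated in parallel.  For every finite set `ι` of
coordinates there is a commutative `𝕜`-algebra `Fn ι`, with the partial derivatives `pd a` and, for
a map `f : ι → κ`, the substitution `pull f` which replaces the coordinate `a` by the coordinate
`f a`.  The results below concern only the two instances `smooth` and `formal`. -/

/-- Function algebras in finitely many coordinates, with partial derivatives and substitutions
of coordinates. -/
structure FunctionAlgebras (𝕜 : Type u) [Field 𝕜] where
  Fn : (ι : Type) → [Fintype ι] → Type u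
  [commRing : ∀ (ι : Type) [Fintype ι], CommRing (Fn ι)]
  [algebra : ∀ (ι : Type) [Fintype ι], Algebra 𝕜 (Fn ι)]
  pd : ∀ {ι : Type} [Fintype ι], ι → Derivation 𝕜 (Fn ι) (Fn ι)
  pull : ∀ {ι κ : Type} [Fintype ι] [Fintype κ], (ι → κ) → Fn ι →ₐ[𝕜] Fn κ
  pd_comm : ∀ {ι : Type} [Fintype ι] (a b : ι) (F : Fn ι), pd a (pd b F) = pd b (pd a F)
  pull_pull : ∀ {ι κ l : Type} [Fintype ι] [Fintype κ] [Fintype l] (f : ι → κ) (g : κ → l)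
    (F : Fn ι), pull g (pull f F) = pull (g ∘ f) F
  pd_pull_of_notMem : ∀ {ι κ : Type} [Fintype ι] [Fintype κ] (f : ι → κ) (b : κ) (F : Fn ι),
    b ∉ Set.range f → pd b (pull f F) = 0

attribute [instance] FunctionAlgebras.commRing FunctionAlgebras.algebra

/-- The algebra of smooth `𝕜`-valued functions on `ℝ^ι`. -/
def SmoothFn (𝕜 : Type u) [RCLike 𝕜] (ι : Type) [Fintype ι] : Subalgebra 𝕜 ((ι → ℝ) → 𝕜) where
  carrier := {F | ContDiff ℝ ∞ F}
  mul_mem' := fun {F G} (hF : ContDiff ℝ ∞ F) (hG : ContDiff ℝ ∞ G) => hF.mul hG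
  add_mem' := fun {F G} (hF : ContDiff ℝ ∞ F) (hG : ContDiff ℝ ∞ G) => hF.add hG
  algebraMap_mem' := fun c =>
    (contDiff_const : ContDiff ℝ ∞ fun _ : ι → ℝ => algebraMap 𝕜 𝕜 c)

theorem contDiff_coe {𝕜 : Type u} [RCLike 𝕜] {ι : Type} [Fintype ι] (F : SmoothFn 𝕜 ι) :
    ContDiff ℝ ∞ F.1 := F.2

theorem differentiableAt_coe {𝕜 : Type u} [RCLike 𝕜] {ι : Type} [Fintype ι]
    (F : SmoothFn 𝕜 ι) (x : ι → ℝ) : DifferentiableAt ℝ F.1 x :=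
  (contDiff_coe F).differentiable (by simp) x

open Classical in
/-- The partial derivative `∂F/∂x_a` of a smooth function. -/
def smoothPd (𝕜 : Type u) [RCLike 𝕜] {ι : Type} [Fintype ι] (a : ι) :
    Derivation 𝕜 (SmoothFn 𝕜 ι) (SmoothFn 𝕜 ι) :=
  Derivation.mk'
    { toFun := fun F => ⟨fun x => fderiv ℝ F.1 x (Pi.single a 1),
        ((contDiff_coe F).fderiv_right (m := ∞) (by simp)).clm_apply contDiff_const⟩
      map_add' := fun F G => by
        refine Subtype.ext (funext fun x => ?_)
        change fderiv ℝ (F.1 + G.1) x _ = fderiv ℝ F.1 x _ + fderiv ℝ G.1 x _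
        rw [fderiv_add (differentiableAt_coe F x) (differentiableAt_coe G x)]
        rfl
      map_smul' := fun c F => by
        refine Subtype.ext (funext fun x => ?_)
        change fderiv ℝ (c • F.1) x _ = c • fderiv ℝ F.1 x _
        rw [fderiv_const_smul (differentiableAt_coe F x)]
        rfl }
    (fun F G => by
        refine Subtype.ext (funext fun x => ?_)
        change fderiv ℝ (F.1 * G.1) x _ = F.1 x * fderiv ℝ G.1 x _ + G.1 x * fderiv ℝ F.1 x _
        rw [fderiv_mul (differentiableAt_coe F x) (differentiableAt_coe G x)]
        rfl)

/-- Substitution of coordinates: `(pull f F)(y) = F(y ∘ f)`. -/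
def smoothPull (𝕜 : Type u) [RCLike 𝕜] {ι κ : Type} [Fintype ι] [Fintype κ] (f : ι → κ) :
    SmoothFn 𝕜 ι →ₐ[𝕜] SmoothFn 𝕜 κ where
  toFun F := ⟨fun y => F.1 (y ∘ f),
    (contDiff_coe F).comp (contDiff_pi.2 fun a => contDiff_apply ℝ ℝ (f a))⟩
  map_one' := rfl
  map_mul' _ _ := rfl
  map_zero' := rfl
  map_add' _ _ := rfl
  commutes' _ := rfl

/-- A function on a real vector space that is invariant under translation in the direction `v` has
vanishing derivative in the direction `v`. -/
theorem fderiv_apply_eq_zero_of_invariant {E F : Type*} [NormedAddCommGroup E] [NormedSpace ℝ E]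
    [NormedAddCommGroup F] [NormedSpace ℝ F] (f : E → F) (x v : E)
    (h : ∀ t : ℝ, f (x + t • v) = f x) : fderiv ℝ f x v = 0 := by
  by_cases hf : DifferentiableAt ℝ f x
  · rw [← hf.lineDeriv_eq_fderiv, lineDeriv]
    simp [h]
  · simp [fderiv_zero_of_not_differentiableAt hf]

/-- Smooth functions on `ℝ^ι`. -/
def smooth (𝕜 : Type u) [RCLike 𝕜] : FunctionAlgebras 𝕜 where
  Fn ι _ := SmoothFn 𝕜 ι
  pd := smoothPd 𝕜
  pull := smoothPull 𝕜
  pd_comm := fun {ι} _ a b F => by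
    classical
    refine Subtype.ext (funext fun x => ?_)
    have h2 : Differentiable ℝ (fderiv ℝ F.1) :=
      ((contDiff_coe F).fderiv_right (m := ∞) (by simp)).differentiable (by simp)
    have hs : IsSymmSndFDerivAt ℝ F.1 x :=
      (contDiff_coe F).contDiffAt.isSymmSndFDerivAt (by
        rw [minSmoothness_of_isRCLikeNormedField]
        exact WithTop.coe_le_coe.2 (le_top : (2 : ℕ∞) ≤ ⊤))
    have key : ∀ v w : ι → ℝ, fderiv ℝ (fun y => fderiv ℝ F.1 y v) x w
        = fderiv ℝ (fderiv ℝ F.1) x w v := by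
      intro v w
      rw [fderiv_clm_apply (h2 x) (differentiableAt_const v)]
      simp
    exact (key _ _).trans ((hs.eq _ _).trans (key _ _).symm)
  pull_pull := fun _ _ _ => rfl
  pd_pull_of_notMem := fun {ι κ} _ _ f b F hb => by
    classical
    refine Subtype.ext (funext fun x => ?_)
    refine fderiv_apply_eq_zero_of_invariant (fun y : κ → ℝ => F.1 (y ∘ f)) x _ fun t => ?_
    refine congrArg F.1 (funext fun a => ?_)
    have : f a ≠ b := fun h => hb ⟨a, h⟩
    simp [this]

/-- Formal power series in the coordinates `ι`. -/
def formal (𝕜 : Type u) [Field 𝕜] : FunctionAlgebras 𝕜 where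
  Fn ι _ := MvPowerSeries ι 𝕜
  pd a := MvPowerSeries.pderiv 𝕜 a
  pull f := MvPowerSeries.rename f
  pd_comm := fun a b F => by
    classical
    ext x
    simp only [MvPowerSeries.coeff_pderiv]
    rcases eq_or_ne a b with rfl | hab
    · rfl
    · simp [hab, hab.symm, add_right_comm]
      ring
  pull_pull := fun f g F => MvPowerSeries.rename_rename f g F
  pd_pull_of_notMem := fun f b F hb => by
    classical
    ext x
    rw [MvPowerSeries.coeff_pderiv, MvPowerSeries.coeff_rename_eq_zero]
    · simp
    · rintro ⟨y, hy⟩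
      have h := DFunLike.congr_fun hy b
      rw [Finsupp.mapDomain_of_notMem_range _ _ hb] at h
      simp at h

/-! ## Polyvector fields, differential forms, Hochschild chains -/

namespace FunctionAlgebras

variable {𝕜 : Type u} [Field 𝕜] (T : FunctionAlgebras 𝕜)

/-- Polyvector fields of degree `k` (sections of `⋀^k T`) on `d`-dimensional space, as alternating
tensors: `γ = γ₁ ∧ ⋯ ∧ γ_k` takes the constant covectors `α₁, …, α_k` to `det (α_a(γ_b))`. -/
abbrev Polyvector (d k : ℕ) : Type u := (Fin d → 𝕜) [⋀^Fin k]→ₗ[𝕜] T.Fn (Fin d)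

/-- Differential `p`-forms on `d`-dimensional space, through their values
`η[v₁ ∧ ⋯ ∧ v_p]` on constant polyvector fields. -/
abbrev Form (d p : ℕ) : Type u := (Fin d → 𝕜) [⋀^Fin p]→ₗ[𝕜] T.Fn (Fin d)

/-- Differential forms of all degrees. -/
abbrev Forms (d : ℕ) : Type u := ∀ p : ℕ, T.Form d p

/-- The derivative `∑ i, v i • ∂_i` in the constant direction `v`. -/
def dirDeriv (d : ℕ) (v : Fin d → 𝕜) : T.Fn (Fin d) →ₗ[𝕜] T.Fn (Fin d) :=
  ∑ i, v i • (T.pd i : T.Fn (Fin d) →ₗ[𝕜] T.Fn (Fin d))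

/-- The de Rham differential of a `p`-form:
`(dη)[v₀ ∧ ⋯ ∧ v_p] = ∑ i, (-1)^i ∂_{v_i} (η[v₀ ∧ ⋯ v̂_i ⋯ ∧ v_p])`. -/
def dForm {d p : ℕ} (η : T.Form d p) : T.Form d (p + 1) :=
  AlternatingMap.alternatizeUncurryFin
    { toFun := fun v => (T.dirDeriv d v).compAlternatingMap η
      map_add' := fun v w => by
        ext
        simp [dirDeriv, add_smul, Finset.sum_add_distrib]
      map_smul' := fun c v => by
        ext
        simp [dirDeriv, mul_smul, Finset.smul_sum] }

/-- The de Rham differential on forms of all degrees. -/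
def deRham {d : ℕ} (η : T.Forms d) : T.Forms d
  | 0 => 0
  | p + 1 => T.dForm (η p)

/-- The completed tensor power `A ⊗̂ ⋯ ⊗̂ A` (`n + 1` factors) of the algebra `A` of functions on
`d`-dimensional space: functions of `n + 1` points; `(l, i)` is the `i`-th coordinate of the `l`-th
point, and `a₀ ⊗ ⋯ ⊗ a_n` is the function `∏ l, a_l(x_l)`. -/
abbrev PreChain (d n : ℕ) : Type u := T.Fn (Fin (n + 1) × Fin d)

/-- Inserting a point at the place `j + 1`. -/
def skip (d : ℕ) {n : ℕ} (j : Fin n) : Fin n × Fin d → Fin (n + 1) × Fin d :=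
  fun a => (j.succ.succAbove a.1, a.2)

/-- Degenerate chains: sums of functions, each independent of one of the points `1, …, n`
(spanned by the `a₀ ⊗ ⋯ ⊗ a_n` in which one of `a₁, …, a_n` is `1`). -/
def degenerate (d n : ℕ) : Submodule 𝕜 (T.PreChain d n) :=
  ⨆ j : Fin n, LinearMap.range (T.pull (skip d j)).toLinearMap

/-- Normalized Hochschild chains `A ⊗ Ā ⊗ ⋯ ⊗ Ā` of degree `n`, where `Ā = A / 𝕜 1`. -/
abbrev Chain (d n : ℕ) : Type u := T.PreChain d n ⧸ T.degenerate d n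

/-- The factor `a_s` of `a₀ ⊗ ⋯ ⊗ a_n` stands at the place `s - t + 1` (with `s - t` modulo
`n + 1`) in `1 ⊗ a_t ⊗ ⋯ ⊗ a_n ⊗ a₀ ⊗ ⋯ ⊗ a_{t-1}`. -/
def cyc (d : ℕ) {n : ℕ} (t : Fin (n + 1)) : Fin (n + 1) × Fin d → Fin (n + 2) × Fin d :=
  fun a => ((a.1 - t).succ, a.2)

/-- `B(a₀ ⊗ ⋯ ⊗ a_n) = ∑ t, (-1)^(n t) 1 ⊗ a_t ⊗ ⋯ ⊗ a_n ⊗ a₀ ⊗ ⋯ ⊗ a_{t-1}`. -/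
def preConnes (d n : ℕ) : T.PreChain d n →ₗ[𝕜] T.PreChain d (n + 1) :=
  ∑ t : Fin (n + 1), ((-1 : 𝕜) ^ (n * (t : ℕ))) • (T.pull (cyc d t)).toLinearMap

theorem pull_mem_degenerate {d n : ℕ} {ι : Type} [Fintype ι] (g : ι → Fin (n + 1) × Fin d)
    (j : Fin n) (hg : ∀ a, (g a).1 ≠ j.succ) (F : T.Fn ι) : T.pull g F ∈ T.degenerate d n := by
  choose h hh using fun a => Fin.exists_succAbove_eq (hg a)
  have : g = skip d j ∘ fun a => (h a, (g a).2) := by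
    funext a
    exact Prod.ext (hh a).symm rfl
  rw [this, ← T.pull_pull]
  exact Submodule.mem_iSup_of_mem j ⟨_, rfl⟩

theorem preConnes_degenerate (d n : ℕ) :
    T.degenerate d n ≤ (T.degenerate d (n + 1)).comap (T.preConnes d n) := by
  refine iSup_le fun j => ?_
  rintro _ ⟨F, rfl⟩
  simp only [Submodule.mem_comap, preConnes, LinearMap.sum_apply, LinearMap.smul_apply,
    AlgHom.toLinearMap_apply, T.pull_pull]
  refine Submodule.sum_mem _ fun t _ => Submodule.smul_mem _ _ ?_
  refine T.pull_mem_degenerate _ (j.succ - t) (fun a => ?_) F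
  simp only [cyc, skip, Function.comp_apply, ne_eq, Fin.succ_inj, sub_left_inj]
  exact Fin.succAbove_ne _ _

/-- Connes' operator on normalized chains. -/
def connes (d n : ℕ) : T.Chain d n →ₗ[𝕜] T.Chain d (n + 1) :=
  Submodule.mapQ _ _ (T.preConnes d n) (T.preConnes_degenerate d n)

/-- The iterated partial derivative along a list of coordinates. -/
def iterPd {ι : Type} [Fintype ι] (l : List ι) : T.Fn ι →ₗ[𝕜] T.Fn ι :=
  l.foldr (fun a φ => φ ∘ₗ (T.pd a : T.Fn ι →ₗ[𝕜] T.Fn ι)) LinearMap.id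

theorem iterPd_eq_zero {ι : Type} [Fintype ι] (b : ι) (F : T.Fn ι) (hF : T.pd b F = 0)
    (l : List ι) (hb : b ∈ l) : T.iterPd l F = 0 := by
  induction l generalizing F with
  | nil => simp at hb
  | cons a l ih =>
    change T.iterPd l (T.pd a F) = 0
    rcases List.mem_cons.1 hb with rfl | h
    · rw [hF, map_zero]
    · exact ih _ (by rw [T.pd_comm, hF, map_zero]) h

end FunctionAlgebras

/-! ## Graphs -/

/-- The non-central vertices: the type I vertices `1, …, m` and the type II vertices
`0̄, …, n̄`. -/
abbrev Vertex (m n : ℕ) : Type := Fin m ⊕ Fin (n + 1)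

/-- The graphs in `G(m, n)` whose central vertex has `p` outgoing edges and whose `j`-th type I
vertex has `k j` outgoing edges.  The star of a type I vertex is the ordered list of the end points
of the edges that start there, without repetition.  No edge ends at the central vertex, and
there are no tadpoles. -/
abbrev Graph (m n p : ℕ) (k : Fin m → ℕ) : Type :=
  {g : (Fin p → Vertex m n) × (∀ j, Fin (k j) → Vertex m n) //
    Function.Injective g.1 ∧ ∀ j, Function.Injective (g.2 j) ∧ ∀ e, g.2 j e ≠ Sum.inl j}

namespace Graph

variable {m n p : ℕ} {k : Fin m → ℕ}

/-- End points of the central edges. -/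
def center (Γ : Graph m n p k) (e : Fin p) : Vertex m n := Γ.1.1 e

/-- End points of the edges starting at the type I vertex `j`. -/
def star (Γ : Graph m n p k) (j : Fin m) (e : Fin (k j)) : Vertex m n := Γ.1.2 j e

/-- The edges: central edges, and edges starting at the other type I vertices. -/
abbrev Edge (p : ℕ) (k : Fin m → ℕ) : Type := Fin p ⊕ (Σ j : Fin m, Fin (k j))

/-- The total order of the edges: first the central ones, then those starting at `1`, and so on,
each star in its own order. -/
def edgeOrder (p : ℕ) (k : Fin m → ℕ) : Edge p k ≃ Fin (p + ∑ j, k j) :=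
  (Equiv.sumCongr (Equiv.refl _) finSigmaFinEquiv).trans finSumFinEquiv

/-- End point of an edge. -/
def target (Γ : Graph m n p k) : Edge p k → Vertex m n :=
  Sum.elim Γ.center fun e => Γ.star e.1 e.2

/-! ## Weights -/

/-- Coordinates on `{z_0̄ = 1}`: the points `z₁, …, z_m`, and the arguments of `z_1̄, …, z_n̄`. -/
abbrev ConfSpace (m n : ℕ) : Type := (Fin m → ℂ) × (Fin n → ℝ)

/-- The (open) configuration space `{z_0̄ = 1}`: `0, z₁, …, z_m` are distinct points of the open unit
disk and `0 < arg z_1̄ < ⋯ < arg z_n̄ < 2π`. -/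
def config (m n : ℕ) : Set (ConfSpace m n) :=
  {x | (∀ j, ‖x.1 j‖ < 1 ∧ x.1 j ≠ 0) ∧ Function.Injective x.1 ∧
    (∀ l, 0 < x.2 l ∧ x.2 l < 2 * Real.pi) ∧ StrictMono x.2}

/-- Position of a vertex. -/
def pos (v : Vertex m n) (x : ConfSpace m n) : ℂ :=
  Sum.elim x.1 (Fin.cons 1 fun l => Complex.exp (x.2 l * Complex.I)) v

/-- The one-form `(1/2π) d arg f = (1/2π) Im (df / f)`, at the point `x` and the tangent
vector `v`. -/
def dArg (f : ConfSpace m n → ℂ) (x v : ConfSpace m n) : ℝ :=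
  1 / (2 * Real.pi) * (fderiv ℝ f x v / f x).im

/-- The angle one-form of an edge: `(1/2π) d arg (z_K / z_0̄)` for a central edge ending at `K`, and
`(1/2π) d arg ((z - w) (1 - z w̄) z̄)`, where `z = z_j` and `w = z_L`, for an edge from `j` to
`L`. -/
def edgeForm (Γ : Graph m n p k) : Edge p k → ConfSpace m n → ConfSpace m n → ℝ
  | Sum.inl e => dArg fun x => pos (Γ.center e) x / pos (n := n) (Sum.inr 0) x
  | Sum.inr ⟨j, e⟩ => dArg fun x =>
      (pos (n := n) (Sum.inl j) x - pos (Γ.star j e) x) *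
        (1 - pos (n := n) (Sum.inl j) x * conj (pos (Γ.star j e) x)) *
          conj (pos (n := n) (Sum.inl j) x)

/-- The coordinate vectors, in the order `x₁, y₁, …, x_m, y_m, arg z_1̄, …, arg z_n̄` (where
`z_j = x_j + i y_j`), which defines the orientation. -/
def coordVec (m n : ℕ) (b : Fin (m * 2 + n)) : ConfSpace m n :=
  Sum.elim (fun a => (Pi.single (finProdFinEquiv.symm a).1
      (if (finProdFinEquiv.symm a).2 = 0 then 1 else Complex.I), 0))
    (fun l => (0, Pi.single l 1)) (finSumFinEquiv.symm b)

/-- The integral of `ω_Γ`, the wedge product of all the edge forms, over the configuration space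
(zero unless the number of edges is the dimension).  The density of a wedge product of `N`
one-forms with respect to `N` coordinates is the determinant of their coefficients. -/
def integral (Γ : Graph m n p k) : ℝ :=
  if h : m * 2 + n = p + ∑ j, k j then
    ∫ x in config m n, Matrix.det (Matrix.of fun a b : Fin (m * 2 + n) =>
      Γ.edgeForm ((edgeOrder p k).symm (Fin.cast h a)) x (coordVec m n b))
  else 0

/-- The weight `w_Γ`. -/
def weight (Γ : Graph m n p k) : ℝ :=
  ((p.factorial : ℝ)⁻¹ * ∏ j, ((k j).factorial : ℝ)⁻¹) * Γ.integral

/-! ## Polydifferential operators -/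

/-- For a labelling of the edges by coordinate directions (`I₀` for the central edges, `I j` for
those starting at `j`), the list of the labels of the edges that end at `v`. -/
def incoming {d : ℕ} (Γ : Graph m n p k) (I₀ : Fin p → Fin d) (I : ∀ j, Fin (k j) → Fin d)
    (v : Vertex m n) : List (Fin d) :=
  ((List.finRange p).filter fun e => Γ.center e = v).map I₀ ++
    (List.finRange m).flatMap fun j =>
      ((List.finRange (k j)).filter fun e => Γ.star j e = v).map (I j)

/-- The labels of the edges that end at the type II vertices, each with its end point. -/
def incomingII {d : ℕ} (Γ : Graph m n p k) (I₀ : Fin p → Fin d) (I : ∀ j, Fin (k j) → Fin d) :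
    List (Fin (n + 1) × Fin d) :=
  (List.finRange (n + 1)).flatMap fun l => (Γ.incoming I₀ I (Sum.inr l)).map fun i => (l, i)

variable {𝕜 : Type u} [Field 𝕜] (T : FunctionAlgebras 𝕜) {d : ℕ}

/-- The summand of the polydifferential operator of `Γ` for a labelling of the edges, without the
factor of the central vertex: every vertex `j` of type I carries the component of `γ_j` given by
the labels of its star, the type II vertices carry the chain, everything is differentiated along
the incoming edges, and the product is restricted to the diagonal. -/
def labelled (Γ : Graph m n p k) (γ : ∀ j, T.Polyvector d (k j))
    (I₀ : Fin p → Fin d) (I : ∀ j, Fin (k j) → Fin d) : T.PreChain d n →ₗ[𝕜] T.Fn (Fin d) :=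
  LinearMap.mulLeft 𝕜 (∏ j : Fin m,
      T.iterPd (Γ.incoming I₀ I (Sum.inl j)) (γ j fun e => Pi.single (I j e) 1)) ∘ₗ
    (T.pull Prod.snd).toLinearMap ∘ₗ T.iterPd (Γ.incomingII I₀ I)

/-- The polydifferential operator `D_Γ(ξ, γ₁ ∧ ⋯ ∧ γ_m; F)`, with the constant polyvector field
`ξ = v₁ ∧ ⋯ ∧ v_p` at the central vertex, as a `p`-form evaluated on `ξ`. The component of `ξ` given
by the labels `I₀` is `det (v_a(I₀ b))`. -/
def operator (Γ : Graph m n p k) (γ : ∀ j, T.Polyvector d (k j)) (F : T.PreChain d n) :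
    T.Form d p :=
  ∑ I₀ : Fin p → Fin d, ∑ I : ∀ j, Fin (k j) → Fin d,
    (LinearMap.toSpanSingleton 𝕜 (T.Fn (Fin d)) (Γ.labelled T γ I₀ I F)).compAlternatingMap
      (Matrix.detRowAlternating.compLinearMap (LinearMap.funLeft 𝕜 𝕜 I₀))

theorem sum_apply {V N ι α : Type*} [AddCommGroup V] [Module 𝕜 V] [AddCommGroup N] [Module 𝕜 N]
    (s : Finset α) (f : α → V [⋀^ι]→ₗ[𝕜] N) (v : ι → V) : (∑ i ∈ s, f i) v = ∑ i ∈ s, f i v := by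
  classical
  induction s using Finset.induction_on with
  | empty => simp
  | insert a s ha ih => simp [Finset.sum_insert ha, ih]

theorem operator_apply (Γ : Graph m n p k) (γ : ∀ j, T.Polyvector d (k j)) (F : T.PreChain d n)
    (v : Fin p → Fin d → 𝕜) : Γ.operator T γ F v =
      ∑ I₀ : Fin p → Fin d, ∑ I : ∀ j, Fin (k j) → Fin d,
        (Matrix.of fun a b => v a (I₀ b)).det • Γ.labelled T γ I₀ I F := by
  simp only [operator, sum_apply, LinearMap.compAlternatingMap_apply,
    LinearMap.toSpanSingleton_apply]
  rfl

theorem operator_eq_zero (Γ : Graph m n p k) (γ : ∀ j, T.Polyvector d (k j)) (j : Fin n)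
    (F : T.Fn (Fin n × Fin d)) (e : Edge p k) (he : Γ.target e = Sum.inr j.succ) :
    Γ.operator T γ (T.pull (FunctionAlgebras.skip d j) F) = 0 := by
  ext v
  rw [operator_apply]
  refine Finset.sum_eq_zero fun I₀ _ => Finset.sum_eq_zero fun I _ => ?_
  obtain ⟨i, hi⟩ : ∃ i, i ∈ Γ.incoming I₀ I (Sum.inr j.succ) := by
    rcases e with e | ⟨l, e⟩
    · refine ⟨I₀ e, List.mem_append_left _ (List.mem_map_of_mem ?_)⟩
      exact List.mem_filter.2 ⟨List.mem_finRange e, by simpa [target] using he⟩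
    · refine ⟨I l e, List.mem_append_right _ (List.mem_flatMap.2 ⟨l, List.mem_finRange l,
        List.mem_map_of_mem ?_⟩)⟩
      exact List.mem_filter.2 ⟨List.mem_finRange e, by simpa [target] using he⟩
  have hmem : (j.succ, i) ∈ Γ.incomingII I₀ I :=
    List.mem_flatMap.2 ⟨j.succ, List.mem_finRange _, List.mem_map_of_mem hi⟩
  have hz : T.iterPd (Γ.incomingII I₀ I) (T.pull (FunctionAlgebras.skip d j) F) = 0 := by
    refine T.iterPd_eq_zero _ _ (T.pd_pull_of_notMem _ _ _ ?_) _ hmem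
    rintro ⟨a, ha⟩
    exact Fin.succAbove_ne _ _ (congrArg Prod.fst ha)
  simp [labelled, hz]

theorem dArg_eq_zero (f : ConfSpace m n → ℂ) (x v : ConfSpace m n)
    (h : ∀ t : ℝ, f (x + t • v) = f x) : dArg f x v = 0 := by
  simp [dArg, fderiv_apply_eq_zero_of_invariant f x v h]

theorem pos_invariant (v : Vertex m n) (j : Fin n) (hv : v ≠ Sum.inr j.succ)
    (x : ConfSpace m n) (t : ℝ) : pos v (x + t • (0, Pi.single j 1)) = pos v x := by
  rcases v with i | l
  · simp [pos]
  · induction l using Fin.cases with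
    | zero => simp [pos]
    | succ l =>
      have : l ≠ j := fun h => hv (by rw [h])
      simp [pos, this]

theorem weight_eq_zero (Γ : Graph m n p k) (j : Fin n)
    (hj : ∀ e, Γ.target e ≠ Sum.inr j.succ) : Γ.weight = 0 := by
  have h0 : ∀ (e : Edge p k) (x : ConfSpace m n), Γ.edgeForm e x (0, Pi.single j 1) = 0 := by
    intro e x
    have he := hj e
    rcases e with e | ⟨l, e⟩
    · refine dArg_eq_zero _ _ _ fun t => ?_
      rw [pos_invariant (Γ.center e) j he, pos_invariant (Sum.inr 0) j (by simp [Fin.ext_iff])]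
    · refine dArg_eq_zero _ _ _ fun t => ?_
      rw [pos_invariant (Γ.star l e) j he, pos_invariant (Sum.inl l) j (by simp)]
  have : Γ.integral = 0 := by
    unfold integral
    split_ifs with h
    · refine MeasureTheory.integral_eq_zero_of_ae (Filter.Eventually.of_forall fun x => ?_)
      refine Matrix.det_eq_zero_of_column_eq_zero (finSumFinEquiv (Sum.inr j)) fun a => ?_
      simpa [coordVec] using h0 _ x
    · rfl
  simp [weight, this]

end Graph

/-! ## The morphism -/

variable {𝕜 : Type u} [RCLike 𝕜] (T : FunctionAlgebras 𝕜) {d m n : ℕ} {k : Fin m → ℕ}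

/-- The sum `∑ Γ, w_Γ D_Γ`, on representatives.  Only the graphs with as many edges at the vertex `j`
as the degree of `γ_j`, and `p` central edges for the `p`-form component, contribute. -/
def preMorphism (γ : ∀ j, T.Polyvector d (k j)) : T.PreChain d n →ₗ[𝕜] T.Forms d where
  toFun F := fun p => ∑ Γ : Graph m n p k, (Γ.weight : 𝕜) • Γ.operator T γ F
  map_add' F G := by
    ext p v
    simp [Graph.sum_apply, Graph.operator_apply, smul_add, Finset.sum_add_distrib]
  map_smul' c F := by
    ext p v
    simp [Graph.sum_apply, Graph.operator_apply, Finset.smul_sum, smul_comm c]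

theorem preMorphism_degenerate (γ : ∀ j, T.Polyvector d (k j)) :
    T.degenerate d n ≤ LinearMap.ker (preMorphism T (n := n) γ) := by
  refine iSup_le fun j => ?_
  rintro _ ⟨F, rfl⟩
  rw [LinearMap.mem_ker]
  funext p
  refine Finset.sum_eq_zero fun Γ _ => ?_
  by_cases h : ∃ e, Γ.target e = Sum.inr j.succ
  · obtain ⟨e, he⟩ := h
    rw [AlgHom.toLinearMap_apply, Γ.operator_eq_zero T γ j F e he, smul_zero]
  · rw [Γ.weight_eq_zero j (not_exists.1 h)]
    simp

/-- The `m`-th Taylor component `U_m(γ₁ ∧ ⋯ ∧ γ_m; ·)` of Shoikhet's morphism, on normalized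
Hochschild chains, for homogeneous polyvector fields `γ_j` of degree `k j`. -/
def morphism (γ : ∀ j, T.Polyvector d (k j)) : T.Chain d n →ₗ[𝕜] T.Forms d :=
  Submodule.liftQ _ (preMorphism T γ) (preMorphism_degenerate T γ)

end Shoikhet

end

/-! The theorem is a comparison of weights with a product rule.

*The differential operators.* By the Leibniz rule, the de Rham differential of the operator of a graph
is the sum over all ways to attach one more central edge; the alternating sum in the de Rham differential
is the Laplace expansion of the determinant along the column of the new edge (`dForm_operator`).
Operators are antisymmetric in the central edges, so that a new edge parallel to an old one gives
zero. On the other side, the first factor of every term of Connes' operator is `1`, hence only graphs in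
which no edge ends at `0̄` contribute; these are the graphs `Γ.rotate t`, where `Γ` has `n + 1`
vertices of type II and `t` says where the new base point lies between them, and the operator of
`Γ.rotate t` on the `t`-th term is the operator of `Γ` (`operator_rotate`). What remains is, for a
graph `Γ` with `p + 1` central edges (`sum_integral_rotate`), the identity
`∑ t, (-1)^(n t) ∫ ω_{Γ.rotate t} = ∑ e, (-1)^e ∫ ω_{Γ without the central edge e}`.

*The weights.* If no edge ends at the base point, the differential form of the graph does not depend on
the base point, and the configuration spaces on the left fit together to the space of all
configurations of `n + 1` points on the circle in cyclic order. This space is the product of a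
circle, the common angle `φ` of all points, and the configuration space with base point
for `Γ`. Under a rotation of all points the angle of a central edge changes by `dφ / 2π` and the
other angles are unchanged, so that integrating over `φ` removes the central edges one at a time
(`density_base`, `unroll_preimage`). Without central edges the form vanishes, which is the
statement in degree zero.

*Integrability.* Splitting the integrals requires that they converge absolutely. The tangents of
the angles are rational functions on the `N`-dimensional configuration space (in suitable
coordinates). Since `N + 1` rational functions of `N` variables are algebraically dependent, almost
all fibres of the map given by `N` such angles have at most `M` points, for some constant `M`. By the
area formula, the integral of the absolute value of the product of the angle forms is at most `M`
times the volume of a torus (`integrableOn_det_im_div`, `integrableOn_density`). -/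

noncomputable section

namespace Shoikhet

open MeasureTheory

/-! ### Integrability of Jacobians of finite-to-one maps -/

/-- The polynomial `C` and the rational functions `A a / B a`, one more than there are variables, satisfy a
nontrivial polynomial relation: all of them lie in a localization of the polynomial ring, which has
transcendence degree the number of variables. -/
theorem exists_algebraic_dependence {ι : Type} [Fintype ι] (A B : ι → MvPolynomial ι ℝ)
    (hB : ∀ a, B a ≠ 0) (C : MvPolynomial ι ℝ) :
    ∃ Q : MvPolynomial (Option ι) ℝ, Q ≠ 0 ∧ ∀ q : ι → ℝ, (∀ a, MvPolynomial.eval q (B a) ≠ 0) →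
      MvPolynomial.eval (fun o => o.elim (MvPolynomial.eval q C)
        fun a => MvPolynomial.eval q (A a) / MvPolynomial.eval q (B a)) Q = 0 := by
  classical
  set P := ∏ a, B a with hP
  have hP0 : P ≠ 0 := Finset.prod_ne_zero_iff.2 fun a _ => hB a
  have hM : Submonoid.powers P ≤ nonZeroDivisors (MvPolynomial ι ℝ) :=
    powers_le_nonZeroDivisors_of_noZeroDivisors hP0
  let L := Localization.Away P
  have : IsDomain L := IsLocalization.isDomain_localization hM
  have : FaithfulSMul (MvPolynomial ι ℝ) L :=
    (faithfulSMul_iff_algebraMap_injective _ _).2 (IsLocalization.injective L hM)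
  have : Algebra.IsAlgebraic (MvPolynomial ι ℝ) L := IsLocalization.isAlgebraic _ (Submonoid.powers P)
  have htr : Algebra.trdeg ℝ L = Cardinal.mk ι := by
    rw [← trdeg_add_eq ℝ (MvPolynomial ι ℝ), trdeg_eq_zero (R := MvPolynomial ι ℝ) (A := L), add_zero,
      MvPolynomial.trdeg_of_isDomain, Cardinal.lift_id]
  have hu : ∀ a, IsUnit (algebraMap (MvPolynomial ι ℝ) L (B a)) := fun a =>
    isUnit_of_dvd_unit (map_dvd _ (Finset.dvd_prod_of_mem B (Finset.mem_univ a)))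
      (IsLocalization.Away.algebraMap_isUnit P)
  choose u hu using hu
  let y : Option ι → L := fun o => o.elim (algebraMap _ L C)
    fun a => algebraMap _ L (A a) * ((u a)⁻¹ : Lˣ)
  have hy : ¬ AlgebraicIndependent ℝ y := by
    intro h
    have h1 := h.cardinalMk_le_trdeg
    rw [htr] at h1
    simp only [Cardinal.mk_fintype, Fintype.card_option] at h1
    norm_cast at h1
    omega
  rw [algebraicIndependent_iff] at hy
  push Not at hy
  obtain ⟨Q, hQ, hQ0⟩ := hy
  refine ⟨Q, hQ0, fun q hq => ?_⟩
  have hunit : ∀ z : Submonoid.powers P,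
      IsUnit ((MvPolynomial.aeval q : MvPolynomial ι ℝ →ₐ[ℝ] ℝ) z) := by
    rintro ⟨z, n, rfl⟩
    rw [map_pow, hP, map_prod]
    exact (IsUnit.mk0 _ (Finset.prod_ne_zero_iff.2 fun a _ => hq a)).pow _
  let φ : L →ₐ[ℝ] ℝ := IsLocalization.liftAlgHom (M := Submonoid.powers P)
    (f := (MvPolynomial.aeval q : MvPolynomial ι ℝ →ₐ[ℝ] ℝ)) hunit
  have hφ : ∀ p, φ (algebraMap _ L p) = MvPolynomial.eval q p := fun p => by
    simp [φ]
  have hφy : φ ∘ y = (fun o => o.elim (MvPolynomial.eval q C)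
        fun a => MvPolynomial.eval q (A a) / MvPolynomial.eval q (B a)) := by
    funext o
    cases o with
    | none => exact hφ C
    | some a =>
      simp only [Function.comp, y, Option.elim, map_mul, hφ]
      rw [eq_div_iff (hq a), mul_assoc, ← hφ (B a), ← hu a, ← map_mul, Units.inv_mul, map_one,
        mul_one]
  have := congrArg φ hQ
  rw [map_zero, MvPolynomial.comp_aeval_apply] at this
  change MvPolynomial.aeval (φ ∘ y) Q = 0 at this
  rw [hφy] at this
  exact this

theorem ae_eval_ne_zero_fin (n : ℕ) (P : MvPolynomial (Fin n) ℝ) (hP : P ≠ 0) :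
    ∀ᵐ x : Fin n → ℝ, MvPolynomial.eval x P ≠ 0 := by
  induction n with
  | zero =>
    refine Filter.Eventually.of_forall fun x hx => hP ?_
    rw [MvPolynomial.eq_C_of_isEmpty P] at hx ⊢
    simpa using hx
  | succ n ih =>
    set Q := MvPolynomial.finSuccEquiv ℝ n P with hQ
    have hQ0 : Q ≠ 0 := by simpa [hQ] using hP
    obtain ⟨i, hi⟩ : ∃ i, Q.coeff i ≠ 0 := by
      by_contra! h
      exact hQ0 (Polynomial.ext h)
    have h1 := ih _ hi
    have hmp := (volume_preserving_piFinSuccAbove (fun _ : Fin (n + 1) => ℝ) 0)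
    have hmeas : MeasurableSet {x : Fin (n + 1) → ℝ | ¬ MvPolynomial.eval x P ≠ 0} := by
      simp only [not_not]
      exact (MvPolynomial.continuous_eval P).measurable (measurableSet_singleton 0)
    rw [ae_iff, ← hmp.symm.measure_preimage hmeas.nullMeasurableSet, Measure.volume_eq_prod,
      Measure.prod_apply_symm (hmp.symm.measurable hmeas), lintegral_eq_zero_iff'
      (measurable_measure_prodMk_right (hmp.symm.measurable hmeas)).aemeasurable]
    refine h1.mono fun y hy => ?_
    -- for almost every `y` the polynomial in the remaining variable is nonzero
    set R := Q.map (MvPolynomial.eval y) with hR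
    have hR0 : R ≠ 0 := fun h => hy (by rw [← Polynomial.coeff_map, ← hR, h, Polynomial.coeff_zero])
    refine measure_mono_null (fun x hx => ?_) (R.roots.toFinset.finite_toSet.measure_zero volume)
    have hx' : MvPolynomial.eval (Fin.cons x y : Fin (n + 1) → ℝ) P = 0 := by
      simpa [MeasurableEquiv.piFinSuccAbove, Fin.insertNthEquiv] using hx
    rw [MvPolynomial.eval_eq_eval_mv_eval'] at hx'
    simpa [hR0] using hx'

theorem ae_eval_ne_zero {ι : Type} [Fintype ι] (P : MvPolynomial ι ℝ) (hP : P ≠ 0) :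
    ∀ᵐ x : ι → ℝ, MvPolynomial.eval x P ≠ 0 := by
  let e := Fintype.equivFin ι
  have h := ae_eval_ne_zero_fin _ (MvPolynomial.rename e P)
    (fun h => hP (MvPolynomial.rename_injective _ e.injective (by simpa using h)))
  have hmp := (volume_measurePreserving_piCongrLeft (fun _ : Fin (Fintype.card ι) => ℝ) e)
  refine (hmp.quasiMeasurePreserving.ae h).mono fun x hx => ?_
  rw [MvPolynomial.eval_rename] at hx
  convert hx using 3
  funext i
  simp [MeasurableEquiv.piCongrLeft, Function.comp]

/-- If almost every point has at most `M` preimages under a differentiable map, then the integral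
of the absolute value of the Jacobian, weighted by a density on the target, is at most `M` times the
integral of the density. -/
theorem lintegral_abs_det_fderiv_mul_le {E : Type*} [NormedAddCommGroup E] [NormedSpace ℝ E]
    [FiniteDimensional ℝ E] [MeasurableSpace E] [BorelSpace E] (μ : Measure E) [μ.IsAddHaarMeasure]
    (f : E → E) (s : Set E) (hs : MeasurableSet s)
    (hf : ∀ x ∈ s, DifferentiableAt ℝ f x) (g : E → ENNReal) (M : ℕ)
    (hM : ∀ᵐ u ∂μ, ∃ t : Finset E, t.card ≤ M ∧ ∀ x ∈ s, f x = u → x ∈ t) (hg : Measurable g) :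
    ∫⁻ x in s, ENNReal.ofReal |(fderiv ℝ f x).det| * g (f x) ∂μ ≤ M * ∫⁻ u, g u ∂μ := by
  classical
  let r : (E →L[ℝ] E) → NNReal := fun A =>
    if h : A.det ≠ 0 then
      if ‖((A.toContinuousLinearEquivOfDetNeZero h).symm : E →L[ℝ] E)‖₊ = 0 then 1 else
        ‖((A.toContinuousLinearEquivOfDetNeZero h).symm : E →L[ℝ] E)‖₊⁻¹ / 2 else 1
  have hr : ∀ A, r A ≠ 0 := by
    intro A
    simp only [r]
    split_ifs with h1 h2
    · exact one_ne_zero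
    · exact div_ne_zero (inv_ne_zero h2) two_ne_zero
    · exact one_ne_zero
  set s₀ := s ∩ {x | (fderiv ℝ f x).det ≠ 0} with hs₀
  have hms₀ : MeasurableSet s₀ := by
    refine hs.inter ?_
    exact (ContinuousLinearMap.continuous_det.measurable.comp (measurable_fderiv ℝ f))
      (measurableSet_singleton (0 : ℝ)).compl
  obtain ⟨t, A, htd, htm, hcov, happ, hA⟩ :=
    exists_partition_approximatesLinearOn_of_hasFDerivWithinAt f s₀ (fderiv ℝ f)
      (fun x hx => (hf x hx.1).hasFDerivAt.hasFDerivWithinAt) r hr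
  have hinj : ∀ n, Set.InjOn f (s₀ ∩ t n) := by
    intro n
    rcases s₀.eq_empty_or_nonempty with h0 | h0
    · simp [h0]
    obtain ⟨y, hy, hAy⟩ := hA h0 n
    have hdet : (A n).det ≠ 0 := hAy ▸ hy.2
    have h1 := happ n
    have h2 : ApproximatesLinearOn f ((A n).toContinuousLinearEquivOfDetNeZero hdet : E →L[ℝ] E)
        (s₀ ∩ t n) (r (A n)) := by simpa using h1
    refine h2.injOn ?_
    by_cases h3 : ‖(((A n).toContinuousLinearEquivOfDetNeZero hdet).symm : E →L[ℝ] E)‖₊ = 0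
    · left
      refine ⟨fun a b => ?_⟩
      have h4 := nnnorm_eq_zero.1 h3
      have h5 : ∀ a, ((A n).toContinuousLinearEquivOfDetNeZero hdet).symm a = 0 := fun a =>
        DFunLike.congr_fun h4 a
      exact ((A n).toContinuousLinearEquivOfDetNeZero hdet).symm.injective (by rw [h5, h5])
    · right
      simp only [r, dif_pos hdet, if_neg h3]
      exact NNReal.half_lt_self (inv_ne_zero h3)
  have hm : ∀ n, MeasurableSet (s₀ ∩ t n) := fun n => hms₀.inter (htm n)
  have hd : ∀ n, ∀ x ∈ s₀ ∩ t n, HasFDerivWithinAt f (fderiv ℝ f x) (s₀ ∩ t n) x :=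
    fun n x hx => (hf x hx.1.1).hasFDerivAt.hasFDerivWithinAt
  have him : ∀ n, MeasurableSet (f '' (s₀ ∩ t n)) := fun n =>
    measurable_image_of_fderivWithin (hm n) (hd n) (hinj n)
  have hU : s₀ = ⋃ n, s₀ ∩ t n := by
    rw [← Set.inter_iUnion, Set.inter_eq_left.2 hcov]
  calc ∫⁻ x in s, ENNReal.ofReal |(fderiv ℝ f x).det| * g (f x) ∂μ
      = ∫⁻ x in s₀, ENNReal.ofReal |(fderiv ℝ f x).det| * g (f x) ∂μ := by
        rw [← lintegral_indicator hs, ← lintegral_indicator hms₀]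
        refine lintegral_congr fun x => ?_
        by_cases hx : x ∈ s
        · by_cases hx0 : (fderiv ℝ f x).det = 0
          · simp [hs₀, Set.indicator, hx0]
          · simp [hs₀, Set.indicator, hx0, hx]
        · simp [hs₀, Set.indicator, hx]
    _ = ∑' n, ∫⁻ x in s₀ ∩ t n, ENNReal.ofReal |(fderiv ℝ f x).det| * g (f x) ∂μ := by
        conv_lhs => rw [hU]
        exact lintegral_iUnion hm (fun i j hij => (htd hij).mono Set.inter_subset_right
          Set.inter_subset_right) _
    _ = ∑' n, ∫⁻ u in f '' (s₀ ∩ t n), g u ∂μ := by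
        refine tsum_congr fun n => ?_
        rw [lintegral_image_eq_lintegral_abs_det_fderiv_mul μ (hm n) (hd n) (hinj n)]
    _ = ∑' n, ∫⁻ u, (f '' (s₀ ∩ t n)).indicator g u ∂μ := by
        refine tsum_congr fun n => ?_
        rw [lintegral_indicator (him n)]
    _ = ∫⁻ u, ∑' n, (f '' (s₀ ∩ t n)).indicator g u ∂μ := by
        rw [lintegral_tsum fun n => (hg.indicator (him n)).aemeasurable]
    _ ≤ ∫⁻ u, M * g u ∂μ := by
        refine lintegral_mono_ae (hM.mono fun u hu => ?_)
        obtain ⟨T, hT, hTu⟩ := hu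
        rw [ENNReal.tsum_eq_iSup_sum]
        refine iSup_le fun N => ?_
        rw [Finset.sum_indicator_eq_sum_filter, Finset.sum_const, nsmul_eq_mul]
        gcongr
        -- the pieces whose image contains `u` contain different preimages of `u`
        refine le_trans ?_ hT
        choose! x hx using fun n (hn : u ∈ f '' (s₀ ∩ t n)) => hn
        refine Finset.card_le_card_of_injOn x ?_ ?_
        · intro n hn
          have hn := (Finset.mem_filter.1 hn).2
          exact hTu _ (hx n hn).1.1.1 (hx n hn).2
        · intro n hn k hk hnk
          have hn := (Finset.mem_filter.1 hn).2
          have hk := (Finset.mem_filter.1 hk).2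
          by_contra hne
          refine Set.disjoint_left.1 (htd hne) (hx n hn).1.2 ?_
          have := (hx k hk).1.2
          rwa [← hnk] at this
    _ = M * ∫⁻ u, g u ∂μ := lintegral_const_mul _ hg

/-! ### Integrability of wedge products of algebraic angle forms -/

/-- On the set `U`, the function `h` is a quotient of polynomials in the functions `q`. -/
def IsRational {E ι : Type*} (q : E → ι → ℝ) (U : Set E) (h : E → ℝ) : Prop :=
  ∃ A B : MvPolynomial ι ℝ, ∀ x ∈ U,
    MvPolynomial.eval (q x) B ≠ 0 ∧ h x = MvPolynomial.eval (q x) A / MvPolynomial.eval (q x) B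

namespace IsRational

variable {E ι : Type*} {q : E → ι → ℝ} {U : Set E} {h k : E → ℝ}

theorem mono {V : Set E} (hh : IsRational q U h) (hV : V ⊆ U) : IsRational q V h := by
  obtain ⟨A, B, H⟩ := hh
  exact ⟨A, B, fun x hx => H x (hV hx)⟩

theorem congr (hh : IsRational q U h) (hk : ∀ x ∈ U, k x = h x) : IsRational q U k := by
  obtain ⟨A, B, H⟩ := hh
  exact ⟨A, B, fun x hx => ⟨(H x hx).1, (hk x hx).trans (H x hx).2⟩⟩

theorem const (c : ℝ) : IsRational q U fun _ => c :=
  ⟨MvPolynomial.C c, 1, fun x _ => by simp⟩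

theorem coord (i : ι) : IsRational q U fun x => q x i :=
  ⟨MvPolynomial.X i, 1, fun x _ => by simp⟩

theorem add (hh : IsRational q U h) (hk : IsRational q U k) :
    IsRational q U fun x => h x + k x := by
  obtain ⟨A, B, H⟩ := hh
  obtain ⟨A', B', H'⟩ := hk
  refine ⟨A * B' + B * A', B * B', fun x hx => ?_⟩
  simp only [map_mul, map_add]
  refine ⟨mul_ne_zero (H x hx).1 (H' x hx).1, ?_⟩
  rw [(H x hx).2, (H' x hx).2, div_add_div _ _ (H x hx).1 (H' x hx).1]

theorem mul (hh : IsRational q U h) (hk : IsRational q U k) :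
    IsRational q U fun x => h x * k x := by
  obtain ⟨A, B, H⟩ := hh
  obtain ⟨A', B', H'⟩ := hk
  refine ⟨A * A', B * B', fun x hx => ?_⟩
  simp only [map_mul]
  refine ⟨mul_ne_zero (H x hx).1 (H' x hx).1, ?_⟩
  rw [(H x hx).2, (H' x hx).2, div_mul_div_comm]

theorem neg (hh : IsRational q U h) : IsRational q U fun x => -h x :=
  ((const (-1)).mul hh).congr fun x _ => by simp

theorem sub (hh : IsRational q U h) (hk : IsRational q U k) :
    IsRational q U fun x => h x - k x :=
  (hh.add hk.neg).congr fun x _ => by ring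

theorem inv (hh : IsRational q U h) (h0 : ∀ x ∈ U, h x ≠ 0) :
    IsRational q U fun x => (h x)⁻¹ := by
  obtain ⟨A, B, H⟩ := hh
  refine ⟨B, A, fun x hx => ⟨fun hA => h0 x hx ?_, ?_⟩⟩
  · rw [(H x hx).2, hA, zero_div]
  · simp only [(H x hx).2, inv_div]

theorem div (hh : IsRational q U h) (hk : IsRational q U k) (h0 : ∀ x ∈ U, k x ≠ 0) :
    IsRational q U fun x => h x / k x :=
  (hh.mul (hk.inv h0)).congr fun _ _ => div_eq_mul_inv _ _

end IsRational

/-- The fibres of a map with rational components are almost all of bounded cardinality: over the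
field of rational functions in `N` variables, each coordinate is algebraically dependent on any
`N` functions. -/
theorem exists_card_fiber_le {E ι : Type} [Fintype ι] (q : E → ι → ℝ) (U : Set E)
    (hq : Set.InjOn q U) (Φ : E → ι → ℝ) (hΦ : ∀ a, IsRational q U fun x => Φ x a) :
    ∃ M : ℕ, ∀ᵐ u : ι → ℝ, ∃ t : Finset E, t.card ≤ M ∧ ∀ x ∈ U, Φ x = u → x ∈ t := by
  classical
  rcases U.eq_empty_or_nonempty with rfl | ⟨x₀, hx₀⟩
  · exact ⟨0, Filter.Eventually.of_forall fun u => ⟨∅, by simp⟩⟩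
  choose A B H using hΦ
  have hB : ∀ a, B a ≠ 0 := fun a h => (H a x₀ hx₀).1 (by rw [h, map_zero])
  choose Q hQ0 hQ using fun c : ι => exists_algebraic_dependence A B hB (MvPolynomial.X c)
  let R : ι → Polynomial (MvPolynomial ι ℝ) := fun c => MvPolynomial.optionEquivLeft ℝ ι (Q c)
  have hR0 : ∀ c, R c ≠ 0 := fun c => by simpa [R] using hQ0 c
  have hlead : ∀ᵐ u : ι → ℝ, ∀ c, MvPolynomial.eval u (R c).leadingCoeff ≠ 0 :=
    ae_all_iff.2 fun c => ae_eval_ne_zero _ (Polynomial.leadingCoeff_ne_zero.2 (hR0 c))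
  refine ⟨∏ c, (R c).natDegree, hlead.mono fun u hu => ?_⟩
  have hmap0 : ∀ c, (R c).map (MvPolynomial.eval u) ≠ 0 := fun c h => hu c (by
    rw [Polynomial.leadingCoeff, ← Polynomial.coeff_map, h, Polynomial.coeff_zero])
  let r : ι → Finset ℝ := fun c => ((R c).map (MvPolynomial.eval u)).roots.toFinset
  have : Nonempty E := ⟨x₀⟩
  refine ⟨(Fintype.piFinset r).image (Function.invFunOn q U), ?_, fun x hx hxu => ?_⟩
  · refine Finset.card_image_le.trans ?_
    rw [Fintype.card_piFinset]
    refine Finset.prod_le_prod' fun c _ => ?_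
    exact (Multiset.toFinset_card_le _).trans ((Polynomial.card_roots' _).trans
      Polynomial.natDegree_map_le)
  · refine Finset.mem_image.2 ⟨q x, Fintype.mem_piFinset.2 fun c => ?_, ?_⟩
    · have h1 := hQ c (q x) fun a => (H a x hx).1
      have h2 : (fun a => MvPolynomial.eval (q x) (A a) / MvPolynomial.eval (q x) (B a)) = u := by
        funext a
        exact (H a x hx).2.symm.trans (congrFun hxu a)
      have h3 := MvPolynomial.optionEquivLeft_elim_eval ℝ ι u (q x c) (Q c)
      simp only [MvPolynomial.eval_X] at h1
      rw [h2] at h1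
      rw [h1] at h3
      simp only [r, Multiset.mem_toFinset, Polynomial.mem_roots (hmap0 c), Polynomial.IsRoot.def]
      exact h3.symm
    · exact hq (Function.invFunOn_mem ⟨x, hx, rfl⟩) hx (Function.invFunOn_eq ⟨x, hx, rfl⟩)

theorem lintegral_prod_inv_one_add_sq_lt_top {ι : Type} [Fintype ι] :
    ∫⁻ u : ι → ℝ, ENNReal.ofReal (∏ a, (1 + u a ^ 2)⁻¹) < ⊤ := by
  have h : Integrable fun u : ι → ℝ => ∏ a, (1 + u a ^ 2)⁻¹ :=
    Integrable.fintype_prod (f := fun _ (x : ℝ) => (1 + x ^ 2)⁻¹)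
      fun _ => integrable_inv_one_add_sq
  exact h.lintegral_lt_top

theorem measurable_det {E ι : Type*} [Fintype ι] [DecidableEq ι] [MeasurableSpace E]
    (A : E → Matrix ι ι ℝ) (hA : ∀ i j, Measurable fun x => A x i j) :
    Measurable fun x => (A x).det := by
  simp only [Matrix.det_apply]
  exact Finset.measurable_sum _ fun σ _ =>
    (Finset.measurable_prod _ fun i _ => hA _ _).const_smul _

/-- The case in which the angles can be measured by the tangents `Im h / Re h`. -/
theorem integrableOn_det_im_div_of_re_ne_zero {E ι : Type} [Fintype ι] [DecidableEq ι]
    [NormedAddCommGroup E] [NormedSpace ℝ E] [FiniteDimensional ℝ E] [MeasurableSpace E]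
    [BorelSpace E] (μ : Measure E) [μ.IsAddHaarMeasure] (b : Module.Basis ι ℝ E) (U : Set E)
    (hU : MeasurableSet U) (q : E → ι → ℝ) (hq : Set.InjOn q U) (h : ι → E → ℂ)
    (hd : ∀ a, Differentiable ℝ (h a)) (hre : ∀ a, IsRational q U fun x => (h a x).re)
    (him : ∀ a, IsRational q U fun x => (h a x).im) (h0 : ∀ a, ∀ x ∈ U, (h a x).re ≠ 0) :
    IntegrableOn (fun x => Matrix.det (Matrix.of fun a c => (fderiv ℝ (h a) x (b c) / h a x).im))
      U μ := by
  let L : E ≃L[ℝ] (ι → ℝ) := b.equivFunL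
  let φ : ι → E → ℝ := fun a x => (h a x).im / (h a x).re
  let Φ : E → E := fun x => L.symm fun a => φ a x
  obtain ⟨M, hM⟩ := exists_card_fiber_le q U hq (fun x a => φ a x)
    fun a => (him a).div (hre a) (h0 a)
  obtain ⟨C, hC⟩ : ∃ C : NNReal, μ.map L = C • (volume : Measure (ι → ℝ)) := by
    have : (μ.map L).IsAddHaarMeasure := L.isAddHaarMeasure_map μ
    exact ⟨_, Measure.isAddLeftInvariant_eq_smul _ _⟩
  have hdφ : ∀ a, ∀ x ∈ U, HasFDerivAt (φ a)
      (((h a x).re ^ 2)⁻¹ • ((h a x).re • Complex.imCLM.comp (fderiv ℝ (h a) x) -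
        (h a x).im • Complex.reCLM.comp (fderiv ℝ (h a) x))) x := fun a x hx => by
    have h1 := (Complex.imCLM.hasFDerivAt (x := h a x)).comp x (hd a x).hasFDerivAt
    have h2 := (Complex.reCLM.hasFDerivAt (x := h a x)).comp x (hd a x).hasFDerivAt
    have h3 := h1.mul ((hasDerivAt_inv (h0 a x hx)).comp_hasFDerivAt x h2)
    refine h3.congr_fderiv ?_
    ext v
    have := h0 a x hx
    simp
    field_simp
    ring
  have hdΦ : ∀ x ∈ U, HasFDerivAt Φ ((L.symm : (ι → ℝ) →L[ℝ] E).comp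
      (ContinuousLinearMap.pi fun a => ((h a x).re ^ 2)⁻¹ • ((h a x).re • Complex.imCLM.comp (fderiv ℝ (h a) x) -
        (h a x).im • Complex.reCLM.comp (fderiv ℝ (h a) x)))) x := fun x hx =>
    (L.symm : (ι → ℝ) →L[ℝ] E).hasFDerivAt.comp x (hasFDerivAt_pi.2 fun a => hdφ a x hx)
  let g : E → ENNReal := fun u => ENNReal.ofReal (∏ a, (1 + L u a ^ 2)⁻¹)
  have hgm : Measurable fun u : ι → ℝ => ENNReal.ofReal (∏ a, (1 + u a ^ 2)⁻¹) := by fun_prop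
  have hg : Measurable g := hgm.comp L.continuous.measurable
  have hgint : ∫⁻ u, g u ∂μ < ⊤ := by
    have : ∫⁻ u, g u ∂μ = ∫⁻ u, ENNReal.ofReal (∏ a, (1 + u a ^ 2)⁻¹) ∂(μ.map L) :=
      (lintegral_map hgm L.continuous.measurable).symm
    rw [this, hC, lintegral_smul_measure]
    exact ENNReal.mul_lt_top (by simp) lintegral_prod_inv_one_add_sq_lt_top
  have hM' : ∀ᵐ u ∂μ, ∃ t : Finset E, t.card ≤ M ∧ ∀ x ∈ U, Φ x = u → x ∈ t := by
    have h1 : ∀ᵐ u ∂(μ.map L), ∃ t : Finset E, t.card ≤ M ∧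
        ∀ x ∈ U, (fun a => φ a x) = u → x ∈ t := by
      rw [hC]
      exact Measure.ae_smul_measure hM C
    refine (ae_of_ae_map L.continuous.measurable.aemeasurable h1).mono fun u hu => ?_
    obtain ⟨t, ht, htu⟩ := hu
    refine ⟨t, ht, fun x hx hxu => htu x hx ?_⟩
    rw [← hxu]
    simp [Φ]
  have key := lintegral_abs_det_fderiv_mul_le μ Φ U hU (fun x hx => (hdΦ x hx).differentiableAt)
    g M hM' hg
  refine ⟨(measurable_det _ fun a c => ?_).aestronglyMeasurable, ?_⟩
  · exact Complex.measurable_im.comp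
      ((measurable_fderiv_apply_const ℝ (h a) (b c)).div (hd a).continuous.measurable)
  refine lt_of_le_of_lt (le_of_eq_of_le ?_ key) (ENNReal.mul_lt_top (by simp) hgint)
  refine setLIntegral_congr_fun hU fun x hx => ?_
  have hdet : (fderiv ℝ Φ x).det = Matrix.det (Matrix.of fun a c =>
      ((h a x).re ^ 2)⁻¹ * ((h a x).re * (fderiv ℝ (h a) x (b c)).im -
        (h a x).im * (fderiv ℝ (h a) x (b c)).re)) := by
    rw [(hdΦ x hx).fderiv, ContinuousLinearMap.det, ← LinearMap.det_toMatrix b]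
    congr 1
    ext a c
    rw [LinearMap.toMatrix_apply]
    change L (L.symm _) a = _
    rw [L.apply_symm_apply]
    simp
  have hfac : (Matrix.of fun a c => (fderiv ℝ (h a) x (b c) / h a x).im) =
      Matrix.of fun a c => (1 + φ a x ^ 2)⁻¹ * (Matrix.of fun a c =>
      ((h a x).re ^ 2)⁻¹ * ((h a x).re * (fderiv ℝ (h a) x (b c)).im -
        (h a x).im * (fderiv ℝ (h a) x (b c)).re)) a c := by
    ext a c
    have h1 := h0 a x hx
    have h2 : (1 + φ a x ^ 2) * (h a x).re ^ 2 = Complex.normSq (h a x) := by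
      simp only [φ, Complex.normSq_apply]
      field_simp
    simp only [Matrix.of_apply]
    rw [← mul_assoc, ← mul_inv, h2, Complex.div_im]
    field_simp
  simp only
  rw [hdet, hfac, Matrix.det_mul_column, enorm_mul, mul_comm, Real.enorm_eq_ofReal_abs,
    Real.enorm_eq_ofReal_abs (∏ a, _), abs_of_nonneg (a := ∏ a, _)
    (Finset.prod_nonneg fun a _ => by positivity)]
  simp [g, Φ]

/-- The wedge product of `N` forms `Im (dh / h)`, for nowhere zero functions `h` which are
rational in `N` functions that separate points, is integrable. -/
theorem integrableOn_det_im_div {E ι : Type} [Fintype ι] [DecidableEq ι]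
    [NormedAddCommGroup E] [NormedSpace ℝ E] [FiniteDimensional ℝ E] [MeasurableSpace E]
    [BorelSpace E] (μ : Measure E) [μ.IsAddHaarMeasure] (b : Module.Basis ι ℝ E) (U : Set E)
    (hU : MeasurableSet U) (q : E → ι → ℝ) (hq : Set.InjOn q U) (h : ι → E → ℂ)
    (hd : ∀ a, Differentiable ℝ (h a)) (hre : ∀ a, IsRational q U fun x => (h a x).re)
    (him : ∀ a, IsRational q U fun x => (h a x).im) (h0 : ∀ a, ∀ x ∈ U, h a x ≠ 0) :
    IntegrableOn (fun x => Matrix.det (Matrix.of fun a c => (fderiv ℝ (h a) x (b c) / h a x).im))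
      U μ := by
  -- The forms do not change when some of the functions are multiplied by `I`.
  let c : Bool → ℂ := fun s => if s then Complex.I else 1
  have hc : ∀ s, c s ≠ 0 := fun s => by cases s <;> simp [c]
  let V : (ι → Bool) → Set E := fun σ => U ∩ {x | ∀ a, (c (σ a) * h a x).re ≠ 0}
  have hV : U = ⋃ σ, V σ := by
    refine Set.Subset.antisymm (fun x hx => ?_) (Set.iUnion_subset fun σ => Set.inter_subset_left)
    refine Set.mem_iUnion.2 ⟨fun a => decide ((h a x).re = 0), hx, fun a => ?_⟩
    by_cases hr : (h a x).re = 0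
    · have : (h a x).im ≠ 0 := fun hi => h0 a x hx (Complex.ext hr hi)
      simpa [c, hr] using this
    · simp [c, hr]
  rw [hV, integrableOn_finite_iUnion]
  intro σ
  have hVU : V σ ⊆ U := Set.inter_subset_left
  have := integrableOn_det_im_div_of_re_ne_zero μ b (V σ) ?_ q (hq.mono hVU)
    (fun a x => c (σ a) * h a x) (fun a => (hd a).const_mul _) ?_ ?_ fun a x hx => hx.2 a
  · refine this.congr_fun_ae (Filter.Eventually.of_forall fun x => ?_)
    simp only
    congr 1
    ext a j
    simp only [Matrix.of_apply]
    rw [fderiv_const_mul (hd a x)]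
    simp [mul_div_mul_left _ _ (hc (σ a))]
  · refine hU.inter ?_
    rw [Set.ofPred_forall]
    refine MeasurableSet.iInter fun a => ?_
    exact (Complex.measurable_re.comp ((hd a).continuous.measurable.const_mul _))
      (measurableSet_singleton (0 : ℝ)).compl
  · intro a
    cases hs : σ a
    · simpa [c] using (hre a).mono hVU
    · simpa [c] using ((him a).mono hVU).neg
  · intro a
    cases hs : σ a
    · simpa [c] using (him a).mono hVU
    · simpa [c] using (hre a).mono hVU

open scoped ComplexConjugate

namespace Graph

variable {m n p : ℕ} {k : Fin m → ℕ}

/-! ### Integrability of the weights -/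

/-- The coordinate vectors form a basis. -/
def coordBasis (m n : ℕ) : Module.Basis (Fin (m * 2 + n)) ℝ (ConfSpace m n) :=
  ((Pi.basis fun _ : Fin m => Complex.basisOneI).prod (Pi.basisFun ℝ (Fin n))).reindex
    ((Equiv.sumCongr ((Equiv.sigmaEquivProd (Fin m) (Fin 2)).trans finProdFinEquiv)
      (Equiv.refl _)).trans finSumFinEquiv)

theorem coordBasis_apply (b : Fin (m * 2 + n)) : coordBasis m n b = coordVec m n b := by
  obtain ⟨b, rfl⟩ := finSumFinEquiv.surjective b
  rcases b with b | l
  · obtain ⟨⟨j, i⟩, rfl⟩ := finProdFinEquiv.surjective b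
    fin_cases i <;> simp [coordBasis, coordVec, Pi.basis_apply, -finProdFinEquiv_symm_apply]
  · simp [coordBasis, coordVec]

/-- Functions on the configuration space which separate its points and in which the positions of
all vertices are rational: the real and imaginary parts of the points of type I, and the cotangents
of half the arguments of the points of type II. -/
def ratCoord (m n : ℕ) (x : ConfSpace m n) (b : Fin (m * 2 + n)) : ℝ :=
  Sum.elim (fun a => if (finProdFinEquiv.symm a).2 = 0 then (x.1 (finProdFinEquiv.symm a).1).re
      else (x.1 (finProdFinEquiv.symm a).1).im)
    (fun l => Real.sin (x.2 l) / (1 - Real.cos (x.2 l))) (finSumFinEquiv.symm b)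

theorem cos_lt_one_of_mem {t : ℝ} (h0 : 0 < t) (h1 : t < 2 * Real.pi) : Real.cos t < 1 := by
  refine lt_of_le_of_ne (Real.cos_le_one t) fun h => ?_
  rw [Real.cos_eq_one_iff_of_lt_of_lt (by linarith) h1] at h
  exact h0.ne' h

theorem cos_eq_of_cot_half {t : ℝ} (h : Real.cos t < 1) :
    Real.cos t = ((Real.sin t / (1 - Real.cos t)) ^ 2 - 1) /
      ((Real.sin t / (1 - Real.cos t)) ^ 2 + 1) := by
  have h1 : 1 - Real.cos t ≠ 0 := by linarith
  rw [eq_div_iff (by positivity), div_pow, Real.sin_sq]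
  field_simp
  ring

theorem sin_eq_of_cot_half {t : ℝ} (h : Real.cos t < 1) :
    Real.sin t = 2 * (Real.sin t / (1 - Real.cos t)) /
      ((Real.sin t / (1 - Real.cos t)) ^ 2 + 1) := by
  have h1 : 1 - Real.cos t ≠ 0 := by linarith
  rw [eq_div_iff (by positivity), div_pow, Real.sin_sq]
  field_simp
  ring

theorem ratCoord_injOn : Set.InjOn (ratCoord m n) (config m n) := by
  intro x hx y hy hxy
  refine Prod.ext (funext fun j => Complex.ext ?_ ?_) (funext fun l => ?_)
  · simpa [ratCoord, -finProdFinEquiv_symm_apply] using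
      congrFun hxy (finSumFinEquiv (Sum.inl (finProdFinEquiv (j, 0))))
  · simpa [ratCoord, -finProdFinEquiv_symm_apply] using
      congrFun hxy (finSumFinEquiv (Sum.inl (finProdFinEquiv (j, 1))))
  · have h : Real.sin (x.2 l) / (1 - Real.cos (x.2 l)) =
        Real.sin (y.2 l) / (1 - Real.cos (y.2 l)) := by
      simpa [ratCoord] using congrFun hxy (finSumFinEquiv (Sum.inr l))
    have hx' := hx.2.2.1 l
    have hy' := hy.2.2.1 l
    have cx := cos_lt_one_of_mem hx'.1 hx'.2
    have cy := cos_lt_one_of_mem hy'.1 hy'.2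
    have hc : Real.cos (x.2 l) = Real.cos (y.2 l) := by
      rw [cos_eq_of_cot_half cx, h, ← cos_eq_of_cot_half cy]
    have hs : Real.sin (x.2 l) = Real.sin (y.2 l) := by
      rw [sin_eq_of_cot_half cx, h, ← sin_eq_of_cot_half cy]
    have h1 : Real.cos (x.2 l - y.2 l) = 1 := by
      rw [Real.cos_sub, hc, hs]
      nlinarith [Real.sin_sq_add_cos_sq (y.2 l)]
    rw [Real.cos_eq_one_iff_of_lt_of_lt (by linarith) (by linarith)] at h1
    linarith

/-- A complex function with rational real and imaginary parts. -/
def IsRationalC {E ι : Type*} (q : E → ι → ℝ) (U : Set E) (h : E → ℂ) : Prop :=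
  IsRational q U (fun x => (h x).re) ∧ IsRational q U fun x => (h x).im

theorem IsRationalC.mul {E ι : Type*} {q : E → ι → ℝ} {U : Set E} {h k : E → ℂ}
    (hh : IsRationalC q U h) (hk : IsRationalC q U k) : IsRationalC q U fun x => h x * k x :=
  ⟨((hh.1.mul hk.1).sub (hh.2.mul hk.2)).congr fun _ _ => Complex.mul_re _ _,
    ((hh.1.mul hk.2).add (hh.2.mul hk.1)).congr fun _ _ => Complex.mul_im _ _⟩

theorem IsRationalC.sub {E ι : Type*} {q : E → ι → ℝ} {U : Set E} {h k : E → ℂ}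
    (hh : IsRationalC q U h) (hk : IsRationalC q U k) : IsRationalC q U fun x => h x - k x :=
  ⟨hh.1.sub hk.1, hh.2.sub hk.2⟩

theorem IsRationalC.conj {E ι : Type*} {q : E → ι → ℝ} {U : Set E} {h : E → ℂ}
    (hh : IsRationalC q U h) : IsRationalC q U fun x => (starRingEnd ℂ) (h x) :=
  ⟨hh.1, hh.2.neg⟩

theorem IsRationalC.const {E ι : Type*} {q : E → ι → ℝ} {U : Set E} (c : ℂ) :
    IsRationalC q U fun _ => c :=
  ⟨.const _, .const _⟩

theorem isRationalC_pos (v : Vertex m n) :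
    IsRationalC (ratCoord m n) (config m n) fun x => pos v x := by
  rcases v with j | l
  · constructor
    · exact (IsRational.coord (finSumFinEquiv (Sum.inl (finProdFinEquiv (j, 0))))).congr
        fun x _ => by simp [ratCoord, pos, -finProdFinEquiv_symm_apply]
    · exact (IsRational.coord (finSumFinEquiv (Sum.inl (finProdFinEquiv (j, 1))))).congr
        fun x _ => by simp [ratCoord, pos, -finProdFinEquiv_symm_apply]
  · induction l using Fin.cases with
    | zero => simpa [pos] using IsRationalC.const 1
    | succ l =>
      have hq : IsRational (ratCoord m n) (config m n)
          fun x => Real.sin (x.2 l) / (1 - Real.cos (x.2 l)) :=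
        (IsRational.coord (finSumFinEquiv (Sum.inr l))).congr fun x _ => by simp [ratCoord]
      have hq2 := (hq.mul hq).add (IsRational.const 1)
      have hq0 : ∀ x ∈ config m n, Real.sin (x.2 l) / (1 - Real.cos (x.2 l)) *
          (Real.sin (x.2 l) / (1 - Real.cos (x.2 l))) + 1 ≠ 0 := fun x _ =>
        (add_pos_of_nonneg_of_pos (mul_self_nonneg _) one_pos).ne'
      constructor
      · refine (((hq.mul hq).sub (IsRational.const 1)).div hq2 hq0).congr fun x hx => ?_
        have h := cos_eq_of_cot_half (cos_lt_one_of_mem (hx.2.2.1 l).1 (hx.2.2.1 l).2)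
        simpa [pos, Complex.exp_ofReal_mul_I_re, ← sq] using h
      · refine (((IsRational.const 2).mul hq).div hq2 hq0).congr fun x hx => ?_
        have h := sin_eq_of_cot_half (cos_lt_one_of_mem (hx.2.2.1 l).1 (hx.2.2.1 l).2)
        simpa [pos, Complex.exp_ofReal_mul_I_im, ← sq] using h

theorem differentiable_pos (v : Vertex m n) : Differentiable ℝ (pos v : ConfSpace m n → ℂ) := by
  rcases v with j | l
  · change Differentiable ℝ fun x : ConfSpace m n => x.1 j
    fun_prop
  · induction l using Fin.cases with
    | zero => exact differentiable_const 1
    | succ l =>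
      change Differentiable ℝ fun x : ConfSpace m n => Complex.exp ((x.2 l : ℝ) * Complex.I)
      have : Differentiable ℝ fun x : ConfSpace m n => ((x.2 l : ℝ) : ℂ) :=
        Complex.ofRealCLM.differentiable.comp (by fun_prop : Differentiable ℝ
          fun x : ConfSpace m n => x.2 l)
      exact (this.mul_const _).cexp

theorem norm_pos_inr (l : Fin (n + 1)) (x : ConfSpace m n) : ‖pos (Sum.inr l : Vertex m n) x‖ = 1 := by
  induction l using Fin.cases with
  | zero => simp [pos]
  | succ l => simp [pos, Complex.norm_exp_ofReal_mul_I]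

theorem pos_ne_zero {x : ConfSpace m n} (hx : x ∈ config m n) (v : Vertex m n) : pos v x ≠ 0 := by
  rcases v with j | l
  · exact (hx.1 j).2
  · rw [← norm_ne_zero_iff, norm_pos_inr]
    exact one_ne_zero

theorem norm_pos_le {x : ConfSpace m n} (hx : x ∈ config m n) (v : Vertex m n) :
    ‖pos v x‖ ≤ 1 := by
  rcases v with j | l
  · exact (hx.1 j).1.le
  · exact (norm_pos_inr l x).le

/-- The function on `ConfSpace m n` whose argument is `2π` times the angle of an edge from the
type I vertex `j` to `v`. -/
def starFun (j : Fin m) (v : Vertex m n) (x : ConfSpace m n) : ℂ :=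
  (pos (n := n) (Sum.inl j) x - pos v x) * (1 - pos (n := n) (Sum.inl j) x * conj (pos v x)) *
    conj (pos (n := n) (Sum.inl j) x)

theorem starFun_ne_zero {x : ConfSpace m n} (hx : x ∈ config m n) (j : Fin m) (v : Vertex m n)
    (hv : v ≠ Sum.inl j) : starFun j v x ≠ 0 := by
  have hj : ‖pos (n := n) (Sum.inl j) x‖ < 1 := (hx.1 j).1
  refine mul_ne_zero (mul_ne_zero (sub_ne_zero.2 fun h => ?_) (sub_ne_zero.2 fun h => ?_)) ?_
  · rcases v with i | l
    · exact hv (congrArg Sum.inl (hx.2.1 h.symm))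
    · rw [h, norm_pos_inr] at hj
      exact lt_irrefl _ hj
  · have h1 := congrArg norm h
    rw [norm_one, norm_mul, RCLike.norm_conj] at h1
    have h2 := mul_le_of_le_one_right (norm_nonneg (pos (n := n) (Sum.inl j) x)) (norm_pos_le hx v)
    linarith
  · simpa using pos_ne_zero hx (Sum.inl j)

theorem differentiable_starFun (j : Fin m) (v : Vertex m n) :
    Differentiable ℝ (starFun j v : ConfSpace m n → ℂ) := by
  have h1 := differentiable_pos (n := n) (Sum.inl j)
  have h2 := differentiable_pos v
  have hc : ∀ {f : ConfSpace m n → ℂ}, Differentiable ℝ f → Differentiable ℝ fun x => conj (f x) :=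
    fun hf => Complex.conjCLE.differentiable.comp hf
  exact ((h1.sub h2).mul ((differentiable_const 1).sub (h1.mul (hc h2)))).mul (hc h1)

/-- The function whose argument is `2π` times the angle of an edge. -/
def edgeFun (Γ : Graph m n p k) : Edge p k → ConfSpace m n → ℂ
  | Sum.inl e => pos (Γ.center e)
  | Sum.inr ⟨j, e⟩ => starFun j (Γ.star j e)

theorem edgeForm_eq (Γ : Graph m n p k) (e : Edge p k) : Γ.edgeForm e = dArg (Γ.edgeFun e) := by
  rcases e with e | ⟨j, e⟩
  · simp only [edgeForm, edgeFun]
    congr 1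
    funext x
    simp [pos]
  · rfl

theorem measurableSet_interior (m : ℕ) : MeasurableSet {z : Fin m → ℂ |
    (∀ j, ‖z j‖ < 1 ∧ z j ≠ 0) ∧ Function.Injective z} := by
  have h : ∀ j, Measurable fun z : Fin m → ℂ => z j := measurable_pi_apply
  have : {z : Fin m → ℂ | (∀ j, ‖z j‖ < 1 ∧ z j ≠ 0) ∧ Function.Injective z} =
      (⋂ j, ({z | ‖z j‖ < 1} ∩ {z | z j ≠ 0})) ∩ ⋂ i, ⋂ j, {z | z i = z j → i = j} := by
    ext x
    simp [Function.Injective]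
  rw [this]
  refine .inter (.iInter fun j => .inter ?_ ?_) (.iInter fun i => .iInter fun j => ?_)
  · exact measurableSet_lt (h j).norm measurable_const
  · exact h j (measurableSet_singleton 0).compl
  · by_cases hij : i = j
    · simp [hij]
    · simp only [hij, imp_false]
      exact (measurableSet_eq_fun (h i) (h j)).compl

theorem measurableSet_strictMono (n : ℕ) : MeasurableSet {φ : Fin n → ℝ | StrictMono φ} := by
  have : {φ : Fin n → ℝ | StrictMono φ} = ⋂ i, ⋂ j, {φ | i < j → φ i < φ j} := by
    ext x
    simp [StrictMono]
  rw [this]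
  refine .iInter fun i => .iInter fun j => ?_
  by_cases hij : i < j
  · simp only [hij, forall_const]
    exact measurableSet_lt (measurable_pi_apply i) (measurable_pi_apply j)
  · simp [hij]

theorem measurableSet_config (m n : ℕ) : MeasurableSet (config m n) := by
  have h : ∀ l, Measurable fun x : ConfSpace m n => x.2 l := fun l => by fun_prop
  have : config m n = Prod.fst ⁻¹' {z | (∀ j, ‖z j‖ < 1 ∧ z j ≠ 0) ∧ Function.Injective z} ∩
      ((⋂ l, ({x : ConfSpace m n | 0 < x.2 l} ∩ {x | x.2 l < 2 * Real.pi})) ∩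
        Prod.snd ⁻¹' {φ | StrictMono φ}) := by
    ext x
    simp [config, and_assoc]
  rw [this]
  refine .inter (measurable_fst (measurableSet_interior m)) (.inter (.iInter fun l => .inter ?_ ?_)
    (measurable_snd (measurableSet_strictMono n)))
  · exact measurableSet_lt measurable_const (h l)
  · exact measurableSet_lt (h l) measurable_const

/-- The density of the product of all edge forms, when the edges are numbered by `σ`. -/
def density (Γ : Graph m n p k) (σ : Fin (m * 2 + n) → Edge p k) (x : ConfSpace m n) : ℝ :=
  Matrix.det (Matrix.of fun a b => Γ.edgeForm (σ a) x (coordVec m n b))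

theorem isAddHaarMeasure_volume (m n : ℕ) :
    (volume : Measure (ConfSpace m n)).IsAddHaarMeasure := by
  exact Measure.prod.instIsAddHaarMeasure _ _

theorem integrableOn_density (Γ : Graph m n p k) (σ : Fin (m * 2 + n) → Edge p k) :
    IntegrableOn (Γ.density σ) (config m n) := by
  have := isAddHaarMeasure_volume m n
  have h := integrableOn_det_im_div (volume : Measure (ConfSpace m n)) (coordBasis m n)
    (config m n) (measurableSet_config m n) (ratCoord m n) ratCoord_injOn
    (fun a => Γ.edgeFun (σ a)) ?_ ?_ ?_ ?_
  · refine (h.const_mul ((1 / (2 * Real.pi)) ^ (m * 2 + n))).congr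
      (Filter.Eventually.of_forall fun x => ?_)
    simp only [density, edgeForm_eq, dArg, coordBasis_apply]
    have := Matrix.det_smul (Matrix.of fun a b => (fderiv ℝ (Γ.edgeFun (σ a)) x (coordVec m n b) /
      Γ.edgeFun (σ a) x).im) (1 / (2 * Real.pi))
    rw [Fintype.card_fin] at this
    rw [← this]
    rfl
  · intro a
    rcases σ a with e | ⟨j, e⟩
    · exact differentiable_pos _
    · exact differentiable_starFun _ _
  all_goals
    have hr : ∀ a, IsRationalC (ratCoord m n) (config m n) (Γ.edgeFun (σ a)) := by
      intro a
      rcases σ a with e | ⟨j, e⟩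
      · exact isRationalC_pos _
      · exact (((isRationalC_pos _).sub (isRationalC_pos _)).mul ((IsRationalC.const 1).sub
          ((isRationalC_pos _).mul (isRationalC_pos _).conj))).mul (isRationalC_pos _).conj
  · exact fun a => (hr a).1
  · exact fun a => (hr a).2
  · intro a x hx
    rcases σ a with e | ⟨j, e⟩
    · exact pos_ne_zero hx _
    · exact starFun_ne_zero hx _ _ ((Γ.2.2 j).2 e)

end Graph

namespace Graph

variable {m n p : ℕ} {k : Fin m → ℕ}

/-! ### Forgetting the base point: cyclic rotation of the points on the circle -/

/-- The embedding of vertices under which the type II vertex `s` becomes the vertex at the place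
`s - t + 1`, as in `cyc`. -/
def rotVertex (t : Fin (n + 1)) : Vertex m n → Vertex m (n + 1) :=
  Sum.map id fun s => (s - t).succ

theorem rotVertex_injective (t : Fin (n + 1)) :
    Function.Injective (rotVertex (m := m) t) :=
  Sum.map_injective.2 ⟨Function.injective_id, fun a b h => by simpa using h⟩

/-- The graph `Γ` with a new base point to which no edge leads, the type II vertices being
rotated by `t`. -/
def rotate (Γ : Graph m n p k) (t : Fin (n + 1)) : Graph m (n + 1) p k :=
  ⟨(fun e => rotVertex t (Γ.1.1 e), fun j e => rotVertex t (Γ.1.2 j e)),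
    (rotVertex_injective t).comp Γ.2.1, fun j => ⟨(rotVertex_injective t).comp (Γ.2.2 j).1,
      fun e h => (Γ.2.2 j).2 e (rotVertex_injective t h)⟩⟩

/-- The graph `Γ` without its central edge `e`. -/
def erase (Γ : Graph m n (p + 1) k) (e : Fin (p + 1)) : Graph m n p k :=
  ⟨(fun a => Γ.1.1 (e.succAbove a), Γ.1.2), Γ.2.1.comp Fin.succAbove_right_injective, Γ.2.2⟩

/-- The complex number whose argument is the angle of an edge, for vertices at the positions `P`. -/
def edgeVal (Γ : Graph m n p k) (e : Edge p k) (P : Vertex m n → ℂ) : ℂ :=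
  Sum.elim (fun e => P (Γ.center e)) (fun e => (P (Sum.inl e.1) - P (Γ.star e.1 e.2)) *
    (1 - P (Sum.inl e.1) * conj (P (Γ.star e.1 e.2))) * conj (P (Sum.inl e.1))) e

theorem edgeFun_eq (Γ : Graph m n p k) (e : Edge p k) :
    Γ.edgeFun e = fun x => Γ.edgeVal e fun v => pos v x := by
  rcases e with e | ⟨j, e⟩ <;> rfl

theorem edgeFun_rotate (Γ : Graph m n p k) (t : Fin (n + 1)) (e : Edge p k)
    (x : ConfSpace m (n + 1)) :
    (Γ.rotate t).edgeFun e x = Γ.edgeVal e fun v => pos (rotVertex t v) x := by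
  rcases e with e | ⟨j, e⟩ <;> rfl

theorem pos_rotVertex (t : Fin (n + 1)) (v : Vertex m n) (x : ConfSpace m (n + 1)) :
    pos (rotVertex t v) x = Sum.elim x.1 (fun s => Complex.exp (x.2 (s - t) * Complex.I)) v := by
  rcases v with j | s <;> rfl

/-- Only the central edges notice a rotation of all points. -/
theorem edgeVal_mul (Γ : Graph m n p k) (e : Edge p k) (u : ℂ) (hu : ‖u‖ = 1)
    (P : Vertex m n → ℂ) : Γ.edgeVal e (fun v => u * P v) =
      Sum.elim (fun _ => u) (fun _ => 1) e * Γ.edgeVal e P := by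
  have h : u * conj u = 1 := by rw [Complex.mul_conj, Complex.normSq_eq_norm_sq, hu]; norm_num
  rcases e with e | ⟨j, e⟩
  · rfl
  · simp only [edgeVal, Sum.elim_inr, map_mul]
    linear_combination ((P (Sum.inl j) - P (Γ.star j e)) * conj (P (Sum.inl j)) -
      (P (Sum.inl j) - P (Γ.star j e)) * (P (Sum.inl j) * conj (P (Γ.star j e))) *
        conj (P (Sum.inl j)) * (u * conj u + 1)) * h

theorem differentiable_edgeFun (Γ : Graph m n p k) (e : Edge p k) :
    Differentiable ℝ (Γ.edgeFun e) := by
  rcases e with e | ⟨j, e⟩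
  · exact differentiable_pos _
  · exact differentiable_starFun _ _

theorem dArg_comp {n' : ℕ} {f : ConfSpace m n → ℂ} {g : ConfSpace m n' → ConfSpace m n}
    {g' : ConfSpace m n' →L[ℝ] ConfSpace m n} {x : ConfSpace m n'} (hg : HasFDerivAt g g' x)
    (hf : DifferentiableAt ℝ f (g x)) (v : ConfSpace m n') :
    dArg f (g x) (g' v) = dArg (fun y => f (g y)) x v := by
  have : fderiv ℝ (fun y => f (g y)) x = (fderiv ℝ f (g x)).comp g' :=
    (hf.hasFDerivAt.comp x hg).fderiv
  simp [dArg, this]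

theorem dArg_const_mul {f : ConfSpace m n → ℂ} {x : ConfSpace m n} (hf : DifferentiableAt ℝ f x)
    {c : ℂ} (hc : c ≠ 0) (v : ConfSpace m n) : dArg (fun y => c * f y) x v = dArg f x v := by
  simp [dArg, fderiv_const_mul hf, mul_div_mul_left _ _ hc]

theorem dArg_sum {ι : Type*} (s : Finset ι) (f : ConfSpace m n → ℂ) (x : ConfSpace m n)
    (c : ι → ℝ) (v : ι → ConfSpace m n) :
    dArg f x (∑ i ∈ s, c i • v i) = ∑ i ∈ s, c i * dArg f x (v i) := by
  simp only [dArg, map_sum, Finset.sum_div, Complex.im_sum, Finset.mul_sum, map_smul,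
    Complex.real_smul]
  refine Finset.sum_congr rfl fun i _ => ?_
  rw [mul_div_assoc, Complex.im_ofReal_mul]
  ring

/-- Composition with a linear map multiplies the product of `N` one-forms by its determinant. -/
theorem det_dArg_map {N : ℕ} (f : Fin (m * 2 + N) → ConfSpace m N → ℂ) (x : ConfSpace m N)
    (A : ConfSpace m N →ₗ[ℝ] ConfSpace m N) :
    Matrix.det (Matrix.of fun a b => dArg (f a) x (A (coordVec m N b))) =
      Matrix.det (Matrix.of fun a b => dArg (f a) x (coordVec m N b)) * LinearMap.det A := by
  rw [← LinearMap.det_toMatrix (coordBasis m N), ← Matrix.det_mul]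
  congr 1
  ext a b
  have h : A (coordVec m N b) = ∑ i, (LinearMap.toMatrix (coordBasis m N) (coordBasis m N) A) i b •
      coordVec m N i := by
    simp only [LinearMap.toMatrix_apply, ← coordBasis_apply]
    exact ((coordBasis m N).sum_repr _).symm
  simp only [Matrix.of_apply, Matrix.mul_apply]
  rw [h, dArg_sum]
  exact Finset.sum_congr rfl fun i _ => mul_comm _ _

/-- Rotation of all points by the angle `φ` (linear part). -/
def rotLin (m n : ℕ) (φ : ℝ) : ConfSpace m n →L[ℝ] ConfSpace m n :=
  (ContinuousLinearMap.pi fun j => (rotation (Circle.exp φ) : ℂ →L[ℝ] ℂ).comp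
    (ContinuousLinearMap.proj j)).prodMap (ContinuousLinearMap.id ℝ (Fin n → ℝ))

/-- Rotation of all points by the angle `φ`. -/
def rot (m n : ℕ) (φ : ℝ) (x : ConfSpace m n) : ConfSpace m n :=
  rotLin m n φ x + (0, fun _ => φ)

theorem rot_fst (φ : ℝ) (x : ConfSpace m n) (j : Fin m) :
    (rot m n φ x).1 j = Complex.exp (φ * Complex.I) * x.1 j := by
  simp [rot, rotLin, rotation_apply]

theorem rot_snd (φ : ℝ) (x : ConfSpace m n) (l : Fin n) : (rot m n φ x).2 l = x.2 l + φ := by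
  simp [rot, rotLin]

theorem hasFDerivAt_rot (φ : ℝ) (x : ConfSpace m n) :
    HasFDerivAt (rot m n φ) (rotLin m n φ) x :=
  (rotLin m n φ).hasFDerivAt.add_const _

theorem det_rotLin (φ : ℝ) :
    LinearMap.det (rotLin m n φ : ConfSpace m n →ₗ[ℝ] ConfSpace m n) = 1 := by
  have h : (rotLin m n φ : ConfSpace m n →ₗ[ℝ] ConfSpace m n) =
      LinearMap.prodMap (LinearMap.pi fun j : Fin m =>
        ((rotation (Circle.exp φ)).toLinearEquiv : ℂ →ₗ[ℝ] ℂ) ∘ₗ LinearMap.proj j)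
        (LinearMap.id : (Fin n → ℝ) →ₗ[ℝ] (Fin n → ℝ)) := rfl
  rw [h, LinearMap.det_prodMap, LinearMap.det_pi]
  simp [det_rotation]

theorem edgeFun_rot (Γ : Graph m n p k) (e : Edge p k) (φ : ℝ) (x : ConfSpace m (n + 1)) :
    (Γ.rotate 0).edgeFun e (rot m (n + 1) φ x) =
      Sum.elim (fun _ => Complex.exp (φ * Complex.I)) (fun _ => 1) e *
        (Γ.rotate 0).edgeFun e x := by
  rw [edgeFun_rotate, edgeFun_rotate, ← edgeVal_mul _ _ _ (Complex.norm_exp_ofReal_mul_I φ)]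
  congr 1
  funext v
  rw [pos_rotVertex, pos_rotVertex]
  rcases v with j | s
  · exact rot_fst φ x j
  · simp only [Sum.elim_inr, rot_snd]
    rw [← Complex.exp_add]
    push_cast
    ring_nf

/-- The density of the rotated graphs is invariant under simultaneous rotation of all points. -/
theorem density_rot (Γ : Graph m n p k) (σ : Fin (m * 2 + (n + 1)) → Edge p k) (φ : ℝ)
    (x : ConfSpace m (n + 1)) :
    (Γ.rotate 0).density σ (rot m (n + 1) φ x) = (Γ.rotate 0).density σ x := by
  have h := det_dArg_map (fun a => (Γ.rotate 0).edgeFun (σ a)) (rot m (n + 1) φ x)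
    (rotLin m (n + 1) φ : ConfSpace m (n + 1) →ₗ[ℝ] ConfSpace m (n + 1))
  rw [det_rotLin, mul_one] at h
  simp only [density, edgeForm_eq]
  rw [← h]
  congr 1
  ext a b
  simp only [Matrix.of_apply, ContinuousLinearMap.coe_coe]
  rw [dArg_comp (hasFDerivAt_rot φ x) (differentiable_edgeFun _ _ _)]
  simp only [edgeFun_rot]
  refine dArg_const_mul (differentiable_edgeFun _ _ _) ?_ _
  rcases σ a with e | e
  · exact Complex.exp_ne_zero _
  · exact one_ne_zero

/-- The density of the rotated graphs is `2π`-periodic in the arguments of the points on the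
circle. -/
theorem density_periodic (Γ : Graph m n p k) (σ : Fin (m * 2 + (n + 1)) → Edge p k)
    (c : Fin (n + 1) → ℤ) (x : ConfSpace m (n + 1)) :
    (Γ.rotate 0).density σ (x + (0, fun s => c s * (2 * Real.pi))) = (Γ.rotate 0).density σ x := by
  simp only [density, edgeForm_eq]
  congr 1
  ext a b
  simp only [Matrix.of_apply]
  have hg : HasFDerivAt (fun y : ConfSpace m (n + 1) => y + (0, fun s => c s * (2 * Real.pi)))
    (ContinuousLinearMap.id ℝ (ConfSpace m (n + 1))) x := (hasFDerivAt_id x).add_const _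
  have := dArg_comp hg (differentiable_edgeFun (Γ.rotate 0) (σ a) _) (coordVec m (n + 1) b)
  rw [ContinuousLinearMap.id_apply] at this
  rw [this]
  congr 1
  funext y
  rw [edgeFun_rotate, edgeFun_rotate]
  congr 1
  funext v
  rw [pos_rotVertex, pos_rotVertex]
  rcases v with j | s
  · simp
  · simp only [Sum.elim_inr, Prod.snd_add, Pi.add_apply]
    rw [Complex.exp_eq_exp_iff_exists_int]
    refine ⟨c (s - 0), ?_⟩
    push_cast
    ring

/-- Cyclic permutation of the points on the circle. -/
def cycLin (m : ℕ) {n : ℕ} (t : Fin (n + 1)) : ConfSpace m (n + 1) →L[ℝ] ConfSpace m (n + 1) :=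
  (ContinuousLinearMap.id ℝ _).prodMap (ContinuousLinearMap.pi fun s =>
    ContinuousLinearMap.proj (s - t))

theorem cycLin_apply (t : Fin (n + 1)) (x : ConfSpace m (n + 1)) :
    cycLin m t x = (x.1, fun s => x.2 (s - t)) := rfl

theorem sign_addRight (t : Fin (n + 1)) :
    Equiv.Perm.sign (Equiv.addRight t) = (-1) ^ (n * (t : ℕ)) := by
  have h : Equiv.addRight t = finRotate (n + 1) ^ (t : ℕ) := by
    have h1 : ∀ i : ℕ, ∀ s : Fin (n + 1),
        (finRotate (n + 1) ^ i) s = s + Fin.ofNat (n + 1) i := by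
      intro i
      induction i with
      | zero => intro s; exact (add_zero s).symm
      | succ i ih =>
        intro s
        rw [pow_succ', Equiv.Perm.mul_apply, ih, finRotate_apply, add_assoc]
        congr 1
        ext
        simp [Fin.val_add]
    ext1 s
    rw [h1, Fin.ofNat_val_eq_self]
    rfl
  rw [h, map_pow, sign_finRotate, ← pow_mul]
  rfl

theorem density_rotate (Γ : Graph m n p k) (σ : Fin (m * 2 + (n + 1)) → Edge p k)
    (t : Fin (n + 1)) (x : ConfSpace m (n + 1)) :
    (Γ.rotate t).density σ x = (-1) ^ (n * (t : ℕ)) * (Γ.rotate 0).density σ (cycLin m t x) := by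
  let π : Equiv.Perm (Fin (m * 2 + (n + 1))) :=
    finSumFinEquiv.permCongr (Equiv.sumCongr (Equiv.refl _) (Equiv.addRight t))
  have hπ : Equiv.Perm.sign π = (-1) ^ (n * (t : ℕ)) := by
    rw [Equiv.Perm.sign_permCongr, ← sign_addRight]
    exact (Equiv.Perm.sign_sumCongr _ _).trans (by simp)
  have hcoord : ∀ b, cycLin m t (coordVec m (n + 1) b) = coordVec m (n + 1) (π b) := by
    intro b
    obtain ⟨b, rfl⟩ := finSumFinEquiv.surjective b
    rcases b with b | l
    · simp only [coordVec, π, Equiv.permCongr_apply, Equiv.symm_apply_apply, cycLin_apply]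
      simp
      rfl
    · simp only [coordVec, π, Equiv.permCongr_apply, Equiv.symm_apply_apply, cycLin_apply]
      simp only [Equiv.sumCongr_apply, Sum.map_inr, Sum.elim_inr]
      refine Prod.ext rfl (funext fun s => ?_)
      simp [Pi.single_apply, sub_eq_iff_eq_add]
  have h := Matrix.det_permute' π (Matrix.of fun a b =>
    dArg ((Γ.rotate 0).edgeFun (σ a)) (cycLin m t x) (coordVec m (n + 1) b))
  rw [hπ] at h
  simp only [density, edgeForm_eq]
  push_cast at h
  rw [← h]
  congr 1
  ext a b
  simp only [Matrix.of_apply, Matrix.submatrix_apply, id]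
  rw [← hcoord, dArg_comp (cycLin m t).hasFDerivAt (differentiable_edgeFun _ _ _)]
  congr 1
  funext y
  rw [edgeFun_rotate, edgeFun_rotate]
  congr 1
  funext v
  rw [pos_rotVertex, pos_rotVertex, cycLin_apply]
  simp

end Graph

namespace Graph

variable {m n p : ℕ} {k : Fin m → ℕ}

/-! ### Contraction with the rotation field -/

/-- The point of the configuration space of `n + 1` free points on the circle whose first free
point is the base point `1`. -/
def base (y : ConfSpace m n) : ConfSpace m (n + 1) := (y.1, Fin.cons 0 y.2)

/-- The linear map `base`. -/
def baseLin (m n : ℕ) : ConfSpace m n →L[ℝ] ConfSpace m (n + 1) :=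
  (ContinuousLinearMap.id ℝ _).prodMap (ContinuousLinearMap.pi
    (Fin.cons 0 fun l => ContinuousLinearMap.proj l))

theorem baseLin_apply (y : ConfSpace m n) : baseLin m n y = base y := by
  refine Prod.ext rfl (funext fun s => ?_)
  induction s using Fin.cases <;> rfl

theorem edgeFun_base (Γ : Graph m n p k) (e : Edge p k) (y : ConfSpace m n) :
    (Γ.rotate 0).edgeFun e (base y) = Γ.edgeFun e y := by
  rw [edgeFun_rotate, edgeFun_eq]
  congr 1
  funext v
  rw [pos_rotVertex]
  rcases v with j | s
  · rfl
  · induction s using Fin.cases <;> simp [base, pos]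

/-- The edges of `Γ.erase e` as edges of `Γ`. -/
def eraseEdge (e : Fin (p + 1)) : Edge p k → Edge (p + 1) k := Sum.map e.succAbove id

theorem edgeFun_eraseEdge (Γ : Graph m n (p + 1) k) (e : Fin (p + 1)) (a : Edge p k) :
    Γ.edgeFun (eraseEdge e a) = (Γ.erase e).edgeFun a := by
  rcases a with a | ⟨j, a⟩ <;> rfl

/-- The velocity of the rotation of all points. -/
def rotField (x : ConfSpace m n) : ConfSpace m n := (fun j => Complex.I * x.1 j, fun _ => 1)

theorem hasDerivAt_rot (x : ConfSpace m n) :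
    HasDerivAt (fun φ : ℝ => rot m n φ x) (rotField x) 0 := by
  have h1 : HasDerivAt (fun φ : ℝ => (rot m n φ x).1) (fun j => Complex.I * x.1 j) 0 := by
    refine hasDerivAt_pi.2 fun j => ?_
    simp only [rot_fst]
    have h2 : HasDerivAt (fun φ : ℝ => (φ : ℂ) * Complex.I) Complex.I 0 := by
      simpa using (Complex.ofRealCLM.hasDerivAt (x := (0 : ℝ))).mul_const Complex.I
    simpa using h2.cexp.mul_const (x.1 j)
  have h2 : HasDerivAt (fun φ : ℝ => (rot m n φ x).2) (fun _ => 1) 0 := by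
    refine hasDerivAt_pi.2 fun l => ?_
    simp only [rot_snd]
    exact (hasDerivAt_id (0 : ℝ)).const_add _
  exact h1.prodMk h2

/-- A central edge turns with the rotation field at unit speed, the other edges do not turn. -/
theorem dArg_rotField (Γ : Graph m n p k) (e : Edge p k) (x : ConfSpace m (n + 1))
    (hx : ∀ c, e = Sum.inl c → (Γ.rotate 0).edgeFun e x ≠ 0) :
    dArg ((Γ.rotate 0).edgeFun e) x (rotField x) =
      Sum.elim (fun _ => 1 / (2 * Real.pi)) (fun _ => 0) e := by
  have h0 : rot m (n + 1) 0 x = x := by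
    refine Prod.ext (funext fun j => ?_) (funext fun l => ?_)
    · simp [rot_fst]
    · simp [rot_snd]
  have h1 : HasDerivAt (fun φ : ℝ => (Γ.rotate 0).edgeFun e (rot m (n + 1) φ x))
      (fderiv ℝ ((Γ.rotate 0).edgeFun e) x (rotField x)) 0 := by
    have h3 := (differentiable_edgeFun (Γ.rotate 0) e (rot m (n + 1) 0 x)).hasFDerivAt
    have h4 := h3.comp_hasDerivAt (0 : ℝ) (hasDerivAt_rot x)
    rw [h0] at h4
    exact h4
  simp only [edgeFun_rot] at h1
  rcases e with e | e
  · have h2 : HasDerivAt (fun φ : ℝ => (φ : ℂ) * Complex.I) Complex.I 0 := by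
      simpa using (Complex.ofRealCLM.hasDerivAt (x := (0 : ℝ))).mul_const Complex.I
    have h3 := h1.unique (h2.cexp.mul_const _)
    simp only [Complex.ofReal_zero, zero_mul, Complex.exp_zero, one_mul] at h3
    simp [dArg, h3, hx e rfl]
  · simp only [Sum.elim_inr, one_mul] at h1
    have h3 := h1.unique (hasDerivAt_const (0 : ℝ) _)
    simp [dArg, h3]

/-- In the density, the coordinate vector of the first point on the circle may be replaced by the
rotation field. -/
theorem density_eq_det_updateCol (Γ : Graph m n p k) (σ : Fin (m * 2 + (n + 1)) → Edge p k)
    (x : ConfSpace m (n + 1)) : (Γ.rotate 0).density σ x = ((Matrix.of fun a b =>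
      dArg ((Γ.rotate 0).edgeFun (σ a)) x (coordVec m (n + 1) b)).updateCol (Fin.natAdd (m * 2) 0)
        fun a => dArg ((Γ.rotate 0).edgeFun (σ a)) x (rotField x)).det := by
  set W := Matrix.of fun a b => dArg ((Γ.rotate 0).edgeFun (σ a)) x (coordVec m (n + 1) b)
  have h1 := Matrix.det_updateCol_sum W (Fin.natAdd (m * 2) 0) fun b =>
    (coordBasis m (n + 1)).repr (rotField x) b
  have h2 : (coordBasis m (n + 1)).repr (rotField x) (Fin.natAdd (m * 2) 0) = 1 := by
    rw [coordBasis, Module.Basis.repr_reindex_apply]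
    have : (Fin.natAdd (m * 2) 0 : Fin (m * 2 + (n + 1))) = finSumFinEquiv (Sum.inr 0) := rfl
    rw [this]
    simp [Module.Basis.prod_repr_inr, rotField]
  rw [h2, one_smul] at h1
  have h3 : (Γ.rotate 0).density σ x = W.det := by
    simp only [density, edgeForm_eq]; rfl
  rw [h3, ← h1]
  congr 2
  funext a
  conv_rhs => rw [← (coordBasis m (n + 1)).sum_repr (rotField x)]
  rw [dArg_sum]
  exact Finset.sum_congr rfl fun b _ => by rw [coordBasis_apply]; rfl

theorem density_rotate_eq_zero (Γ : Graph m n 0 k) (σ : Fin (m * 2 + (n + 1)) → Edge 0 k)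
    (x : ConfSpace m (n + 1)) : (Γ.rotate 0).density σ x = 0 := by
  rw [density_eq_det_updateCol]
  refine Matrix.det_eq_zero_of_column_eq_zero (Fin.natAdd (m * 2) 0) fun a => ?_
  rw [Matrix.updateCol_self, dArg_rotField Γ (σ a) x fun c => c.elim0]
  rcases σ a with e | e
  · exact e.elim0
  · rfl

/-- The contraction with the rotation field: the only dependence of the product of the edge forms of
`Γ` on the common angle is through the central edges, each of which contributes `dφ / 2π`. -/
theorem density_base (Γ : Graph m n (p + 1) k) (h : m * 2 + n = p + ∑ j, k j)
    (h' : m * 2 + (n + 1) = p + 1 + ∑ j, k j) (y : ConfSpace m n) (hy : y ∈ config m n) :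
    (Γ.rotate 0).density (fun a => (edgeOrder (p + 1) k).symm (Fin.cast h' a)) (base y) =
      ∑ e : Fin (p + 1), (-1) ^ (e : ℕ) * (1 / (2 * Real.pi)) *
        (Γ.erase e).density (fun a => (edgeOrder p k).symm (Fin.cast h a)) y := by
  set σ : Fin (m * 2 + (n + 1)) → Edge (p + 1) k :=
    fun a => (edgeOrder (p + 1) k).symm (Fin.cast h' a)
  let b₀ : Fin (m * 2 + (n + 1)) := Fin.natAdd (m * 2) 0
  let W : Matrix (Fin (m * 2 + (n + 1))) (Fin (m * 2 + (n + 1))) ℝ := Matrix.of fun a b =>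
    dArg ((Γ.rotate 0).edgeFun (σ a)) (base y) (coordVec m (n + 1) b)
  have hfield : ∀ a, dArg ((Γ.rotate 0).edgeFun (σ a)) (base y) (rotField (base y)) =
      Sum.elim (fun _ => 1 / (2 * Real.pi)) (fun _ => 0) (σ a) := fun a => by
    refine dArg_rotField Γ (σ a) (base y) fun c hc => ?_
    rw [hc, edgeFun_base]
    exact pos_ne_zero hy _
  have hdet : (Γ.rotate 0).density σ (base y) = (W.updateCol b₀ fun a =>
      Sum.elim (fun _ => 1 / (2 * Real.pi)) (fun _ => 0) (σ a)).det := by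
    rw [density_eq_det_updateCol]
    simp only [hfield]
    rfl
  rw [hdet]
  have hdim : m * 2 + (n + 1) = (m * 2 + n).succ := rfl
  rw [Matrix.det_succ_column (n := m * 2 + n) _ b₀]
  -- the rows of the non-central edges do not contribute
  let r : Fin (p + 1) ⊕ Fin (∑ j, k j) ≃ Fin (m * 2 + n).succ :=
    finSumFinEquiv.trans (finCongr h'.symm)
  rw [← r.sum_comp, Fintype.sum_sum_type]
  have hzero : ∀ i, σ (r (Sum.inr i)) = Sum.inr (finSigmaFinEquiv.symm i) := by
    intro i
    simp [σ, r, edgeOrder]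
  have hone : ∀ e, σ (r (Sum.inl e)) = Sum.inl e := by
    intro e
    simp [σ, r, edgeOrder]
  rw [add_eq_left.2]
  · refine Finset.sum_congr rfl fun e _ => ?_
    have hval : ((r (Sum.inl e) : Fin (m * 2 + n).succ) : ℕ) = e := rfl
    have hb : (b₀ : ℕ) = m * 2 := rfl
    simp only [Matrix.updateCol_self]
    rw [hval, hb, hone, pow_add, pow_mul' (-1 : ℝ) m 2, neg_one_sq, one_pow, mul_one]
    simp only [Sum.elim_inl]
    congr 1
    simp only [density, edgeForm_eq]
    congr 1
    ext a b
    have hne : b₀.succAbove b ≠ b₀ := Fin.succAbove_ne _ _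
    simp only [Matrix.submatrix_apply, Matrix.of_apply]
    rw [Matrix.updateCol_ne hne]
    have hrow : σ ((r (Sum.inl e)).succAbove a) =
        eraseEdge e ((edgeOrder p k).symm (Fin.cast h a)) := by
      obtain ⟨x, rfl⟩ : ∃ x, a = Fin.cast h.symm (edgeOrder p k x) :=
        ⟨(edgeOrder p k).symm (Fin.cast h a), by simp⟩
      simp only [σ, Fin.cast_cast, Fin.cast_eq_self, Equiv.symm_apply_apply]
      rw [Equiv.symm_apply_eq]
      ext
      rcases x with x | x
      · simp only [edgeOrder, eraseEdge, Fin.val_cast, Equiv.trans_apply, Equiv.sumCongr_apply,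
          Sum.map_inl, finSumFinEquiv_apply_left, Fin.val_castAdd, Fin.succAbove, Fin.lt_def,
          Fin.val_castSucc, hval, Equiv.refl_apply]
        split_ifs <;> simp
      · simp only [edgeOrder, eraseEdge, Fin.val_cast, Equiv.trans_apply, Equiv.sumCongr_apply,
          Sum.map_inr, finSumFinEquiv_apply_right, Fin.val_natAdd, Fin.succAbove, Fin.lt_def,
          Fin.val_castSucc, hval, id]
        have := e.2
        split_ifs
        · omega
        · simp only [Fin.val_succ, Fin.val_cast, Fin.val_natAdd]
          omega
    have hcol : coordVec m (n + 1) (b₀.succAbove b) = baseLin m n (coordVec m n b) := by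
      obtain ⟨b, rfl⟩ := finSumFinEquiv.surjective b
      rw [baseLin_apply]
      rcases b with b | l
      · have : b₀.succAbove (finSumFinEquiv (Sum.inl b)) =
            (finSumFinEquiv (Sum.inl b) : Fin (m * 2 + (n + 1))) := by
          ext
          have := b.2
          simp only [finSumFinEquiv_apply_left, Fin.succAbove, Fin.lt_def, hb, Fin.val_castSucc,
            Fin.val_castAdd]
          rw [if_pos this]
          rfl
        rw [this]
        simp only [coordVec, Equiv.symm_apply_apply, Sum.elim_inl, base]
        refine Prod.ext rfl (funext fun s => ?_)
        induction s using Fin.cases <;> rfl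
      · have : b₀.succAbove (finSumFinEquiv (Sum.inr l)) =
            (finSumFinEquiv (Sum.inr l.succ) : Fin (m * 2 + (n + 1))) := by
          ext
          simp only [finSumFinEquiv_apply_right, Fin.succAbove, Fin.lt_def, hb, Fin.val_castSucc,
            Fin.val_natAdd]
          rw [if_neg (by omega)]
          simp
          omega
        rw [this]
        simp only [coordVec, Equiv.symm_apply_apply, Sum.elim_inr, base]
        refine Prod.ext rfl (funext fun s => ?_)
        induction s using Fin.cases with
        | zero => simp
        | succ s => simp [Pi.single_apply]
    simp only [W, Matrix.of_apply]
    have hbase : HasFDerivAt base (baseLin m n) y := by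
      have := (baseLin m n).hasFDerivAt (x := y)
      rwa [show (⇑(baseLin m n) : ConfSpace m n → _) = base from funext baseLin_apply] at this
    rw [hrow, hcol, dArg_comp hbase (differentiable_edgeFun _ _ _)]
    simp only [edgeFun_base, edgeFun_eraseEdge]
  · refine Finset.sum_eq_zero fun i _ => ?_
    simp only [Matrix.updateCol_self]
    rw [hzero]
    simp

end Graph

namespace Graph

variable {m n p : ℕ} {k : Fin m → ℕ}

/-! ### Integration over the common angle -/

/-- The space of interior points together with `n + 1` free points on the circle in cyclic order,
given by arguments `ψ₀ < ψ₁ < ⋯ < ψ_n < ψ₀ + 2π` with `0 < ψ₀ < 2π`. -/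
def turnSet (m n : ℕ) : Set (ConfSpace m (n + 1)) :=
  {x | (∀ j, ‖x.1 j‖ < 1 ∧ x.1 j ≠ 0) ∧ Function.Injective x.1 ∧
    ((0 < x.2 0 ∧ x.2 0 < 2 * Real.pi) ∧ StrictMono x.2 ∧ ∀ s, x.2 s < x.2 0 + 2 * Real.pi)}

/-- The part of `turnSet` in which precisely the points `s ≥ t` (none of them, for `t = 0`) have
arguments beyond `2π`. -/
def turnPiece (m : ℕ) {n : ℕ} (t : Fin (n + 1)) : Set (ConfSpace m (n + 1)) :=
  {x ∈ turnSet m n | ∀ s, if 0 < t ∧ t ≤ s then 2 * Real.pi < x.2 s else x.2 s < 2 * Real.pi}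

/-- The number of turns to be added to the argument of the point `s` in `turnPiece m t`. -/
def winding (t s : Fin (n + 1)) : ℤ := if 0 < t ∧ t ≤ s then 1 else 0

/-- The parametrization of `turnPiece m t` by the configurations with base point. -/
def turnMap (m : ℕ) {n : ℕ} (t : Fin (n + 1)) (x : ConfSpace m (n + 1)) : ConfSpace m (n + 1) :=
  cycLin m t x + (0, fun s => winding t s * (2 * Real.pi))

/-- An increasing sequence of angles that spans less than one turn, starts in `(0, 2π)` and passes `2π`
exactly from the index `t` on (never, if `t = 0`) is, reduced modulo `2π` and cyclically shifted by
`t`, an increasing sequence in `(0, 2π)`; and conversely. -/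
theorem strictMono_rotate_iff (t : Fin (n + 1)) (φ ψ : Fin (n + 1) → ℝ)
    (hψ : ∀ s, ψ s = φ (s - t) + winding t s * (2 * Real.pi)) :
    (((0 < ψ 0 ∧ ψ 0 < 2 * Real.pi) ∧ StrictMono ψ ∧ ∀ s, ψ s < ψ 0 + 2 * Real.pi) ∧
      ∀ s, if 0 < t ∧ t ≤ s then 2 * Real.pi < ψ s else ψ s < 2 * Real.pi) ↔
    (∀ l, 0 < φ l ∧ φ l < 2 * Real.pi) ∧ StrictMono φ := by
  have h0 : ¬ (0 < t ∧ t ≤ 0) := fun h => absurd h.1 (not_lt.2 h.2)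
  have hle : ∀ s, t ≤ s → ((s - t : Fin (n + 1)) : ℕ) = s - t := fun s hs => Fin.coe_sub_iff_le.2 hs
  have hlt : ∀ s, s < t → ((s - t : Fin (n + 1)) : ℕ) = n + 1 + s - t :=
    fun s hs => Fin.coe_sub_iff_lt.2 hs
  have hin : ∀ s, 0 < t ∧ t ≤ s → ψ s = φ (s - t) + 2 * Real.pi := fun s hs => by
    rw [hψ, winding, if_pos hs]; simp
  have hout : ∀ s, ¬ (0 < t ∧ t ≤ s) → ψ s = φ (s - t) := fun s hs => by
    rw [hψ, winding, if_neg hs]; simp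
  constructor
  · rintro ⟨⟨⟨ha, hb⟩, hmono, hlast⟩, hsep⟩
    have hge : ∀ s, ψ 0 ≤ ψ s := fun s => hmono.monotone (Fin.zero_le s)
    have hall : ∀ s, 0 < φ (s - t) ∧ φ (s - t) < 2 * Real.pi := by
      intro s
      have h1 := hsep s
      have h2 := hlast s
      have h3 := hge s
      split_ifs at h1 with hs
      · rw [hin s hs] at h1 h2 h3
        constructor <;> linarith
      · rw [hout s hs] at h1 h3
        constructor <;> linarith
    refine ⟨fun l => by simpa using hall (l + t), fun i j hij => ?_⟩
    obtain ⟨s, rfl⟩ : ∃ s, i = s - t := ⟨i + t, by simp⟩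
    obtain ⟨s', rfl⟩ : ∃ s, j = s - t := ⟨j + t, by simp⟩
    rw [Fin.lt_def] at hij
    by_cases hs : 0 < t ∧ t ≤ s <;> by_cases hs' : 0 < t ∧ t ≤ s'
    · have : s < s' := by
        rw [hle _ hs.2, hle _ hs'.2] at hij
        rw [Fin.lt_def]; omega
      have := hmono this
      rw [hin s hs, hin s' hs'] at this
      linarith
    · have h1 := hlast s
      have h2 := hge s'
      rw [hin s hs] at h1
      rw [hout s' hs'] at h2
      linarith
    · have h1 := s.2
      by_cases ht : 0 < t
      · rw [hlt s (by simpa [ht] using hs), hle s' hs'.2] at hij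
        omega
      · exact absurd hs'.1 ht
    · have : s < s' := by
        by_cases ht : 0 < t
        · rw [hlt s (by simpa [ht] using hs), hlt s' (by simpa [ht] using hs')] at hij
          rw [Fin.lt_def]; omega
        · have : t = 0 := by simpa using ht
          subst this
          simpa using hij
      have := hmono this
      rwa [hout s hs, hout s' hs'] at this
  · rintro ⟨hφ, hmono⟩
    have hψ0 := hout 0 h0
    refine ⟨⟨?_, fun s s' hss' => ?_, fun s => ?_⟩, fun s => ?_⟩
    · rw [hψ0]
      exact hφ _
    · by_cases hs : 0 < t ∧ t ≤ s <;> by_cases hs' : 0 < t ∧ t ≤ s'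
      · have : s - t < s' - t := by
          rw [Fin.lt_def, hle _ hs.2, hle _ hs'.2]
          have := hs.2
          simp only [Fin.lt_def, Fin.le_def] at *
          omega
        rw [hin s hs, hin s' hs']
        linarith [hmono this]
      · exact absurd ⟨hs.1, hs.2.trans hss'.le⟩ hs'
      · rw [hout s hs, hin s' hs']
        linarith [(hφ (s - t)).2, (hφ (s' - t)).1]
      · rw [hout s hs, hout s' hs']
        refine hmono ?_
        by_cases ht : 0 < t
        · have h1 : s < t := by simpa [ht] using hs
          have h2 : s' < t := by simpa [ht] using hs'
          rw [Fin.lt_def, hlt s h1, hlt s' h2]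
          simp only [Fin.lt_def] at *
          omega
        · have : t = 0 := by simpa using ht
          subst this
          simpa using hss'
    · rw [hψ0]
      by_cases hs : 0 < t ∧ t ≤ s
      · rw [hin s hs]
        have : s - t < 0 - t := by
          rw [Fin.lt_def, hle _ hs.2, hlt 0 hs.1]
          have h1 := s.2
          have h2 := hs.2
          have h3 := hs.1
          simp only [Fin.lt_def, Fin.le_def, Fin.val_zero] at *
          omega
        linarith [hmono this]
      · rw [hout s hs]
        linarith [(hφ (s - t)).2, (hφ (0 - t)).1]
    · split_ifs with hs
      · rw [hin s hs]
        linarith [(hφ (s - t)).1]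
      · rw [hout s hs]
        exact (hφ _).2

theorem turnMap_preimage (t : Fin (n + 1)) :
    turnMap m t ⁻¹' turnPiece m t = config m (n + 1) := by
  ext x
  have h := strictMono_rotate_iff t x.2 (turnMap m t x).2 fun s => by
    simp [turnMap, cycLin_apply]
  have h1 : (turnMap m t x).1 = x.1 := by simp [turnMap, cycLin_apply]
  simp only [Set.mem_preimage, turnPiece, turnSet, Set.mem_ofPred_eq, config, h1]
  rw [and_assoc, and_assoc, h]

theorem pairwise_disjoint_turnPiece (m n : ℕ) :
    Pairwise (Function.onFun Disjoint fun t : Fin (n + 1) => turnPiece m t) := by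
  have key : ∀ t t' : Fin (n + 1), t < t' → Disjoint (turnPiece m t) (turnPiece m t') := by
    intro t t' htt'
    refine Set.disjoint_left.2 fun x hx hx' => ?_
    by_cases ht : 0 < t
    · have h1 := hx.2 t
      have h2 := hx'.2 t
      rw [if_pos ⟨ht, le_rfl⟩] at h1
      rw [if_neg fun h => absurd h.2 (not_le.2 htt')] at h2
      linarith
    · have h1 := hx.2 t'
      have h2 := hx'.2 t'
      rw [if_neg fun h => ht h.1] at h1
      rw [if_pos ⟨lt_of_le_of_lt (Fin.zero_le t) htt', le_rfl⟩] at h2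
      linarith
  intro t t' htt'
  rcases lt_or_gt_of_ne htt' with h | h
  · exact key _ _ h
  · exact (key _ _ h).symm

theorem turnSet_ae_eq (m n : ℕ) :
    turnSet m n =ᵐ[volume] ⋃ t : Fin (n + 1), turnPiece m t := by
  have hne : ∀ᵐ x : ConfSpace m (n + 1), ∀ s, x.2 s ≠ 2 * Real.pi := by
    refine ae_all_iff.2 fun s => ?_
    have h1 : ∀ᵐ a : ℝ, a ≠ 2 * Real.pi := by simp [ae_iff]
    have h2 := (Measure.quasiMeasurePreserving_eval
      (fun _ : Fin (n + 1) => (volume : Measure ℝ)) s).ae h1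
    exact (Measure.quasiMeasurePreserving_snd (μ := (volume : Measure (Fin m → ℂ)))
      (ν := (volume : Measure (Fin (n + 1) → ℝ)))).ae h2
  refine Filter.eventuallyEq_set.2 (hne.mono fun x hx => ?_)
  refine ⟨fun h => ?_, fun h => ?_⟩
  · rw [Set.mem_iUnion]
    have hmono := h.2.2.2.1
    by_cases hex : ∃ s, 2 * Real.pi < x.2 s
    · classical
      refine ⟨Fin.find _ hex, h, fun s => ?_⟩
      have h1 : 2 * Real.pi < x.2 (Fin.find _ hex) := Fin.find_spec hex
      split_ifs with hs
      · exact h1.trans_le (hmono.monotone hs.2)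
      · have h0 : 0 < Fin.find _ hex := by
          rw [Fin.pos_iff_ne_zero]
          intro h0
          rw [h0] at h1
          exact lt_asymm h1 h.2.2.1.2
        have h2 : s < Fin.find _ hex := not_le.1 fun h => hs ⟨h0, h⟩
        exact lt_of_le_of_ne (not_lt.1 (Fin.find_min hex h2)) (hx s)
    · push Not at hex
      refine ⟨0, h, fun s => ?_⟩
      rw [if_neg fun h => lt_irrefl _ h.1]
      exact lt_of_le_of_ne (hex s) (hx s)
  · obtain ⟨t, ht⟩ := Set.mem_iUnion.1 h
    exact ht.1

theorem measurableSet_turnSet (m n : ℕ) : MeasurableSet (turnSet m n) := by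
  have h : ∀ l, Measurable fun x : ConfSpace m (n + 1) => x.2 l := fun l => by fun_prop
  have : turnSet m n = Prod.fst ⁻¹' {z | (∀ j, ‖z j‖ < 1 ∧ z j ≠ 0) ∧ Function.Injective z} ∩
      (({x : ConfSpace m (n + 1) | 0 < x.2 0} ∩ {x | x.2 0 < 2 * Real.pi}) ∩ (Prod.snd ⁻¹' {φ | StrictMono φ} ∩
        ⋂ s, {x | x.2 s < x.2 0 + 2 * Real.pi})) := by
    ext x
    simp [turnSet, and_assoc]
  rw [this]
  refine .inter (measurable_fst (measurableSet_interior m)) (.inter (.inter ?_ ?_)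
    (.inter (measurable_snd (measurableSet_strictMono (n + 1))) (.iInter fun s => ?_)))
  · exact measurableSet_lt measurable_const (h 0)
  · exact measurableSet_lt (h 0) measurable_const
  · exact measurableSet_lt (h s) ((h 0).add_const _)

theorem measurableSet_turnPiece (t : Fin (n + 1)) : MeasurableSet (turnPiece m t) := by
  have h2 : ∀ l, Measurable fun x : ConfSpace m (n + 1) => x.2 l := fun l => by fun_prop
  have : turnPiece m t = turnSet m n ∩ ⋂ s, {x | if 0 < t ∧ t ≤ s then 2 * Real.pi < x.2 s else
      x.2 s < 2 * Real.pi} := by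
    ext x
    simp [turnPiece]
  rw [this]
  refine (measurableSet_turnSet m n).inter (.iInter fun s => ?_)
  split_ifs
  · exact measurableSet_lt measurable_const (h2 s)
  · exact measurableSet_lt (h2 s) measurable_const

theorem measurePreserving_turnMap (t : Fin (n + 1)) : MeasurePreserving (turnMap m t) := by
  have := isAddHaarMeasure_volume m (n + 1)
  have h1 : MeasurePreserving (fun x : ConfSpace m (n + 1) => cycLin m t x) := by
    have h : (fun x : ConfSpace m (n + 1) => cycLin m t x) = Prod.map id
        (MeasurableEquiv.piCongrLeft (fun _ : Fin (n + 1) => ℝ) (Equiv.addRight t)) := by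
      funext x
      refine Prod.ext rfl (funext fun s => ?_)
      simp [cycLin_apply, MeasurableEquiv.piCongrLeft, Equiv.piCongrLeft, sub_eq_add_neg]
    rw [h]
    exact (MeasurePreserving.id (volume : Measure (Fin m → ℂ))).prod
      (volume_measurePreserving_piCongrLeft (fun _ : Fin (n + 1) => ℝ) (Equiv.addRight t))
  exact (measurePreserving_add_right volume _).comp h1

theorem measurableEmbedding_turnMap (t : Fin (n + 1)) : MeasurableEmbedding (turnMap m t) := by
  refine Continuous.measurableEmbedding ?_ fun x y hxy => ?_
  · unfold turnMap
    fun_prop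
  · have h : cycLin m t x = cycLin m t y := add_right_cancel hxy
    rw [cycLin_apply, cycLin_apply] at h
    obtain ⟨h1, h2⟩ := Prod.mk.inj h
    refine Prod.ext h1 (funext fun s => ?_)
    simpa using congrFun h2 (s + t)

/-- The points on the circle are rotated by `φ`, starting from the base point. -/
def unroll (m n : ℕ) (q : ℝ × ConfSpace m n) : ConfSpace m (n + 1) :=
  rot m (n + 1) q.1 (base q.2)

theorem unroll_eq (q : ℝ × ConfSpace m n) : unroll m n q =
    ((rot m n q.1 q.2).1, Fin.cons q.1 (rot m n q.1 q.2).2) := by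
  refine Prod.ext (funext fun j => ?_) (funext fun s => ?_)
  · simp [unroll, rot_fst, base]
  · induction s using Fin.cases <;> simp [unroll, rot_snd, base]

theorem measurePreserving_rot (φ : ℝ) : MeasurePreserving (rot m n φ) := by
  have := isAddHaarMeasure_volume m n
  have h1 : MeasurePreserving (fun x : ConfSpace m n => rotLin m n φ x) := by
    refine ⟨(rotLin m n φ).continuous.measurable, ?_⟩
    have := Measure.map_linearMap_addHaar_eq_smul_addHaar (volume : Measure (ConfSpace m n))
      (f := (rotLin m n φ : ConfSpace m n →ₗ[ℝ] ConfSpace m n)) (by rw [det_rotLin]; exact one_ne_zero)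
    rw [det_rotLin] at this
    simpa using this
  exact (measurePreserving_add_right volume _).comp h1

theorem continuous_rot : Continuous fun q : ℝ × ConfSpace m n => rot m n q.1 q.2 := by
  refine continuous_prodMk.2 ⟨continuous_pi fun j => ?_, continuous_pi fun l => ?_⟩
  · change Continuous fun q : ℝ × ConfSpace m n => (rot m n q.1 q.2).1 j
    simp only [rot_fst]
    fun_prop
  · change Continuous fun q : ℝ × ConfSpace m n => (rot m n q.1 q.2).2 l
    simp only [rot_snd]
    fun_prop

theorem measurePreserving_unroll (m n : ℕ) : MeasurePreserving (unroll m n) := by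
  have hA : MeasurePreserving (fun q : ℝ × ConfSpace m n => (q.1, rot m n q.1 q.2)) :=
    (MeasurePreserving.id (volume : Measure ℝ)).skew_product
      (g := fun φ x => rot m n φ x) continuous_rot.measurable
      (Filter.Eventually.of_forall fun φ => (measurePreserving_rot φ).map_eq)
  have hB : MeasurePreserving (fun q : ℝ × ConfSpace m n =>
      ((q.2.1, Fin.cons q.1 q.2.2) : ConfSpace m (n + 1))) := by
    have h1 := (measurePreserving_prodAssoc (volume : Measure ℝ) (volume : Measure (Fin m → ℂ))
      (volume : Measure (Fin n → ℝ))).symm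
    have h2 := (Measure.measurePreserving_swap (μ := (volume : Measure ℝ))
      (ν := (volume : Measure (Fin m → ℂ)))).prod
      (MeasurePreserving.id (volume : Measure (Fin n → ℝ)))
    have h3 := measurePreserving_prodAssoc (volume : Measure (Fin m → ℂ)) (volume : Measure ℝ)
      (volume : Measure (Fin n → ℝ))
    have h4 := (MeasurePreserving.id (volume : Measure (Fin m → ℂ))).prod
      (volume_preserving_piFinSuccAbove (fun _ : Fin (n + 1) => ℝ) 0).symm
    have h : (fun q : ℝ × ConfSpace m n => ((q.2.1, Fin.cons q.1 q.2.2) : ConfSpace m (n + 1))) =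
        Prod.map id (MeasurableEquiv.piFinSuccAbove (fun _ => ℝ) 0).symm ∘
          MeasurableEquiv.prodAssoc ∘ Prod.map Prod.swap id ∘ MeasurableEquiv.prodAssoc.symm := by
      funext q
      refine Prod.ext rfl (funext fun s => ?_)
      simp [MeasurableEquiv.piFinSuccAbove, MeasurableEquiv.prodAssoc]
    rw [h]
    exact h4.comp (h3.comp (h2.comp h1))
  have := hB.comp hA
  convert this using 1
  funext q
  exact unroll_eq q

theorem measurableEmbedding_unroll (m n : ℕ) : MeasurableEmbedding (unroll m n) := by
  refine Continuous.measurableEmbedding ?_ fun q q' h => ?_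
  · have : Continuous fun q : ℝ × ConfSpace m n => (q.1, (base q.2 : ConfSpace m (n + 1))) := by
      simp only [← baseLin_apply]
      exact continuous_fst.prodMk ((baseLin m n).continuous.comp continuous_snd)
    have h := Continuous.comp (continuous_rot (m := m) (n := n + 1)) this
    have he : unroll m n = (fun q : ℝ × ConfSpace m (n + 1) => rot m (n + 1) q.1 q.2) ∘
      fun q : ℝ × ConfSpace m n => (q.1, base q.2) := rfl
    rw [he]
    exact h
  · rw [unroll_eq, unroll_eq] at h
    obtain ⟨hz, hs⟩ := Prod.mk.inj h
    have h1 : q.1 = q'.1 := congrFun hs 0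
    refine Prod.ext h1 (Prod.ext (funext fun j => ?_) (funext fun l => ?_))
    · have := congrFun hz j
      simp only [rot_fst, h1] at this
      exact mul_left_cancel₀ (Complex.exp_ne_zero _) this
    · have := congrFun hs l.succ
      simp only [Fin.cons_succ, rot_snd, h1] at this
      exact add_right_cancel this

theorem unroll_preimage (m n : ℕ) :
    unroll m n ⁻¹' turnSet m n = Set.Ioo 0 (2 * Real.pi) ×ˢ config m n := by
  ext ⟨φ, x⟩
  have hn : ∀ j, ‖(rot m n φ x).1 j‖ = ‖x.1 j‖ := fun j => by
    rw [rot_fst, norm_mul, Complex.norm_exp_ofReal_mul_I, one_mul]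
  have hz : ∀ j, (rot m n φ x).1 j ≠ 0 ↔ x.1 j ≠ 0 := fun j => by
    rw [← norm_ne_zero_iff, hn, norm_ne_zero_iff]
  have hi : Function.Injective (rot m n φ x).1 ↔ Function.Injective x.1 := by
    have : (rot m n φ x).1 = (fun z => Complex.exp (φ * Complex.I) * z) ∘ x.1 :=
      funext fun j => rot_fst φ x j
    rw [this]
    exact (mul_right_injective₀ (Complex.exp_ne_zero _)).of_comp_iff _
  simp only [Set.mem_preimage, unroll_eq, turnSet, Set.mem_ofPred_eq, hn, hz, hi, Fin.cons_zero,
    Set.mem_prod, Set.mem_Ioo, config]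
  have hc : (StrictMono (Fin.cons φ (rot m n φ x).2 : Fin (n + 1) → ℝ) ∧
      ∀ s, (Fin.cons φ (rot m n φ x).2 : Fin (n + 1) → ℝ) s < φ + 2 * Real.pi) ↔
      (∀ l, 0 < x.2 l ∧ x.2 l < 2 * Real.pi) ∧ StrictMono x.2 := by
    constructor
    · rintro ⟨h1, h2⟩
      refine ⟨fun l => ⟨?_, ?_⟩, fun i j hij => ?_⟩
      · have := h1 (Fin.succ_pos l)
        simpa [rot_snd] using this
      · have := h2 l.succ
        simp only [Fin.cons_succ, rot_snd] at this
        linarith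
      · have := h1 (Fin.succ_lt_succ_iff.2 hij)
        simpa [rot_snd] using this
    · rintro ⟨h1, h2⟩
      refine ⟨fun i j hij => ?_, fun s => ?_⟩
      · induction j using Fin.cases with
        | zero => exact absurd hij (Fin.not_lt_zero i)
        | succ j =>
          induction i using Fin.cases with
          | zero => simpa [rot_snd] using (h1 j).1
          | succ i => simpa [rot_snd] using h2 (Fin.succ_lt_succ_iff.1 hij)
      · induction s using Fin.cases with
        | zero => simpa using Real.pi_pos
        | succ s =>
          simp only [Fin.cons_succ, rot_snd]
          linarith [(h1 s).2]
  rw [hc]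
  tauto

end Graph

namespace Graph

variable {m n p : ℕ} {k : Fin m → ℕ}

theorem integral_eq (Γ : Graph m n p k) (h : m * 2 + n = p + ∑ j, k j) :
    Γ.integral = ∫ x in config m n,
      Γ.density (fun a => (edgeOrder p k).symm (Fin.cast h a)) x := by
  rw [integral, dif_pos h]
  rfl

theorem volume_eq_prod_volume (m n : ℕ) : (volume : Measure (ℝ × ConfSpace m n)) =
    (volume : Measure ℝ).prod volume := rfl

/-- The weights of the graphs with a free base point, in terms of the density on the space of
`n + 1` free points on the circle: this space is cut into the pieces in which the base point lies
between two given consecutive points. -/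
theorem sum_setIntegral_rotate (Γ : Graph m n p k) (σ : Fin (m * 2 + (n + 1)) → Edge p k)
    (hint : IntegrableOn ((Γ.rotate 0).density σ) (turnSet m n)) :
    ∑ t : Fin (n + 1), (-1) ^ (n * (t : ℕ)) * ∫ x in config m (n + 1), (Γ.rotate t).density σ x =
      ∫ x in turnSet m n, (Γ.rotate 0).density σ x := by
  rw [setIntegral_congr_set (turnSet_ae_eq m n), integral_iUnion_fintype
    (fun t => measurableSet_turnPiece t) (pairwise_disjoint_turnPiece m n)
    fun t => hint.mono_set fun x hx => hx.1]
  refine Finset.sum_congr rfl fun t _ => ?_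
  rw [← (measurePreserving_turnMap t).setIntegral_preimage_emb (measurableEmbedding_turnMap t)
      _ (turnPiece m t), turnMap_preimage, ← integral_const_mul]
  congr 1
  funext x
  rw [density_rotate, ← mul_assoc, ← pow_add, Even.neg_one_pow ⟨_, rfl⟩, one_mul, turnMap,
    density_periodic]

/-- The identity of weights behind the theorem: for a graph `Γ` with `p + 1` central edges, the
weights of the graphs with a new, free base point add up to the weights of the graphs in which a
central edge is removed. -/
theorem sum_integral_rotate (Γ : Graph m n (p + 1) k) :
    ∑ t : Fin (n + 1), (-1) ^ (n * (t : ℕ)) * (Γ.rotate t).integral =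
      ∑ e : Fin (p + 1), (-1) ^ (e : ℕ) * (Γ.erase e).integral := by
  by_cases h : m * 2 + n = p + ∑ j, k j
  · have h' : m * 2 + (n + 1) = p + 1 + ∑ j, k j := by omega
    set σ := fun a => (edgeOrder p k).symm (Fin.cast h a)
    set σ' := fun a => (edgeOrder (p + 1) k).symm (Fin.cast h' a)
    let F : ConfSpace m n → ℝ := fun y => ∑ e : Fin (p + 1),
      (-1) ^ (e : ℕ) * (1 / (2 * Real.pi)) * (Γ.erase e).density σ y
    have hF : IntegrableOn F (config m n) :=
      integrable_finsetSum _ fun e _ => ((Γ.erase e).integrableOn_density σ).const_mul _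
    have hm : MeasurableSet (Set.Ioo 0 (2 * Real.pi) ×ˢ config m n) :=
      measurableSet_Ioo.prod (measurableSet_config m n)
    have hDF : ∀ q ∈ Set.Ioo 0 (2 * Real.pi) ×ˢ config m n,
        (Γ.rotate 0).density σ' (unroll m n q) = F q.2 := fun q hq => by
      rw [unroll, density_rot, density_base Γ h h' q.2 hq.2]
    have hres : (volume : Measure (ℝ × ConfSpace m n)).restrict
        (Set.Ioo 0 (2 * Real.pi) ×ˢ config m n) =
        (volume.restrict (Set.Ioo 0 (2 * Real.pi))).prod (volume.restrict (config m n)) := by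
      rw [volume_eq_prod_volume, Measure.prod_restrict]
    have hint : IntegrableOn ((Γ.rotate 0).density σ') (turnSet m n) := by
      rw [← (measurePreserving_unroll m n).integrableOn_comp_preimage
        (measurableEmbedding_unroll m n), unroll_preimage]
      refine IntegrableOn.congr_fun ?_ (fun q hq => (hDF q hq).symm) hm
      rw [IntegrableOn, hres]
      exact hF.comp_snd _
    calc ∑ t : Fin (n + 1), (-1) ^ (n * (t : ℕ)) * (Γ.rotate t).integral
        = ∑ t : Fin (n + 1), (-1) ^ (n * (t : ℕ)) *
            ∫ x in config m (n + 1), (Γ.rotate t).density σ' x := by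
          refine Finset.sum_congr rfl fun t _ => ?_
          rw [integral_eq _ h']
      _ = ∫ x in turnSet m n, (Γ.rotate 0).density σ' x := sum_setIntegral_rotate Γ σ' hint
      _ = ∫ q in Set.Ioo 0 (2 * Real.pi) ×ˢ config m n, F q.2 := by
          rw [← (measurePreserving_unroll m n).setIntegral_preimage_emb
            (measurableEmbedding_unroll m n), unroll_preimage]
          exact setIntegral_congr_fun hm hDF
      _ = 2 * Real.pi * ∫ y in config m n, F y := by
          rw [hres, integral_fun_snd]
          simp [Real.pi_pos.le]
      _ = ∑ e : Fin (p + 1), (-1) ^ (e : ℕ) * (Γ.erase e).integral := by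
          rw [integral_finsetSum _ fun e _ => ((Γ.erase e).integrableOn_density σ).const_mul _,
            Finset.mul_sum]
          refine Finset.sum_congr rfl fun e _ => ?_
          rw [integral_eq _ h, integral_const_mul]
          have := Real.pi_ne_zero
          field_simp
          rfl
  · have h' : ¬ m * 2 + (n + 1) = p + 1 + ∑ j, k j := by omega
    simp [integral, h, h']

/-- Without central edges, the weight of a graph with a free base point vanishes. -/
theorem integral_rotate_eq_zero (Γ : Graph m n 0 k) (t : Fin (n + 1)) :
    (Γ.rotate t).integral = 0 := by
  by_cases h : m * 2 + (n + 1) = 0 + ∑ j, k j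
  · rw [integral_eq _ h]
    refine setIntegral_eq_zero_of_forall_eq_zero fun x _ => ?_
    rw [density_rotate]
    rw [density_rotate_eq_zero, mul_zero]
  · rw [integral, dif_neg h]

end Graph

universe u

namespace FunctionAlgebras

/-! ### The chain rule -/

open Classical in
/-- The chain rule for substitutions of coordinates. -/
def ChainRule {𝕜 : Type u} [Field 𝕜] (T : FunctionAlgebras 𝕜) : Prop :=
  ∀ {ι κ : Type} [Fintype ι] [Fintype κ] (f : ι → κ) (b : κ) (F : T.Fn ι),
    T.pd b (T.pull f F) = ∑ a, if f a = b then T.pull f (T.pd a F) else 0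

end FunctionAlgebras

theorem chainRule_smooth (𝕜 : Type u) [RCLike 𝕜] : (smooth 𝕜).ChainRule := by
  classical
  intro ι κ _ _ f b F
  let L : (κ → ℝ) →L[ℝ] (ι → ℝ) := ContinuousLinearMap.pi fun a => ContinuousLinearMap.proj (f a)
  have hsum : ∀ (s : Finset ι) (G : ι → SmoothFn 𝕜 ι) (x : κ → ℝ),
      ((∑ a ∈ s, if f a = b then smoothPull 𝕜 f (G a) else 0 : SmoothFn 𝕜 κ) : (κ → ℝ) → 𝕜) x =
      ∑ a ∈ s, if f a = b then (G a).1 (x ∘ f) else 0 := by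
    intro s G x
    induction s using Finset.induction_on with
    | empty => rfl
    | insert a s ha ih =>
      rw [Finset.sum_insert ha, Finset.sum_insert ha, ← ih]
      split_ifs <;> rfl
  refine Subtype.ext (funext fun x => ?_)
  refine Eq.trans ?_ (hsum Finset.univ (fun a => smoothPd 𝕜 a F) x).symm
  have h1 : fderiv ℝ (fun y : κ → ℝ => F.1 (L y)) x = (fderiv ℝ F.1 (L x)).comp L :=
    ((differentiableAt_coe F (L x)).hasFDerivAt.comp x L.hasFDerivAt).fderiv
  have h2 : L (Pi.single b 1) = ∑ a, if f a = b then Pi.single a 1 else 0 := by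
    funext i
    rw [Finset.sum_apply, Finset.sum_eq_single i]
    · simp only [L, ContinuousLinearMap.coe_pi', ContinuousLinearMap.proj_apply, Pi.single_apply]
      split_ifs <;> simp
    · intro j _ hj
      split_ifs
      · simp [hj.symm]
      · rfl
    · simp
  change fderiv ℝ (fun y : κ → ℝ => F.1 (L y)) x (Pi.single b 1) = _
  rw [h1, ContinuousLinearMap.comp_apply, h2, map_sum]
  refine Finset.sum_congr rfl fun a _ => ?_
  split_ifs
  · rfl
  · simp

open Classical in
theorem pderiv_rename {𝕜 : Type u} [Field 𝕜] {ι κ : Type} [Fintype ι] [Fintype κ] (f : ι → κ)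
    (b : κ) (F : MvPowerSeries ι 𝕜) :
    MvPowerSeries.pderiv 𝕜 b (MvPowerSeries.rename f F) = ∑ a, if f a = b then
      MvPowerSeries.rename f (MvPowerSeries.pderiv 𝕜 a F) else 0 := by
  ext y
  have hmem : ∀ (x : ι →₀ ℕ) (y : κ →₀ ℕ), x ∈ (Filter.TendstoCofinite.finite_preimage_singleton
      (Finsupp.mapDomain f) y).toFinset ↔ Finsupp.mapDomain f x = y := fun x y => by simp
  rw [MvPowerSeries.coeff_pderiv, MvPowerSeries.coeff_rename, map_sum, Finset.sum_mul]
  have h1 : ∀ x : ι →₀ ℕ, Finsupp.mapDomain f x = y + Finsupp.single b 1 →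
      ((y b : 𝕜) + 1) = ∑ a, if f a = b then (x a : 𝕜) else 0 := by
    intro x hx
    have h2 : Finsupp.mapDomain f x b = ∑ a, if f a = b then x a else 0 := by
      rw [Finsupp.mapDomain, Finsupp.sum_fintype _ _ (by simp), Finsupp.finsetSum_apply]
      exact Finset.sum_congr rfl fun a _ => by rw [Finsupp.single_apply]
    rw [hx] at h2
    simp only [Finsupp.add_apply, Finsupp.single_eq_same] at h2
    have := congrArg (Nat.cast : ℕ → 𝕜) h2
    push_cast at this
    exact this
  rw [Finset.sum_congr rfl fun x hx => by rw [h1 x ((hmem _ _).1 hx), Finset.mul_sum],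
    Finset.sum_comm]
  refine Finset.sum_congr rfl fun a _ => ?_
  split_ifs with ha
  · rw [MvPowerSeries.coeff_rename]
    symm
    refine Finset.sum_of_injOn (fun x => x + Finsupp.single a 1) (fun x _ x' _ h =>
      add_right_cancel h) ?_ ?_ ?_
    · intro x hx
      have hx := (hmem _ _).1 hx
      refine (hmem _ _).2 ?_
      rw [Finsupp.mapDomain_add, hx, Finsupp.mapDomain_single, ha]
    · intro x hx hx'
      have hx := (hmem _ _).1 hx
      have : x a = 0 := by
        by_contra h0
        refine hx' ⟨x - Finsupp.single a 1, (hmem _ _).2 ?_, ?_⟩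
        · have h3 : x - Finsupp.single a 1 + Finsupp.single a 1 = x :=
            tsub_add_cancel_of_le (by simpa [Nat.one_le_iff_ne_zero] using h0)
          have h4 := Finsupp.mapDomain_add (f := f) (v₁ := x - Finsupp.single a 1)
            (v₂ := Finsupp.single a 1)
          rw [h3, hx, Finsupp.mapDomain_single, ha] at h4
          exact (add_right_cancel h4).symm
        · exact tsub_add_cancel_of_le (by simpa [Nat.one_le_iff_ne_zero] using h0)
      simp [this]
    · intro x _
      rw [MvPowerSeries.coeff_pderiv]
      simp
  · simp

theorem chainRule_formal (𝕜 : Type u) [Field 𝕜] : (formal 𝕜).ChainRule :=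
  fun f b F => pderiv_rename f b F

namespace FunctionAlgebras

variable {𝕜 : Type u} [Field 𝕜] (T : FunctionAlgebras 𝕜)

/-! ### Iterated derivatives along multisets -/

theorem iterPd_perm {ι : Type} [Fintype ι] {l l' : List ι} (h : l.Perm l') :
    T.iterPd l = T.iterPd l' := by
  refine LinearMap.ext fun F => ?_
  induction h generalizing F with
  | nil => rfl
  | cons a _ ih => exact ih (T.pd a F)
  | swap a b l =>
    change T.iterPd l (T.pd a (T.pd b F)) = T.iterPd l (T.pd b (T.pd a F))
    rw [T.pd_comm]
  | trans _ _ ih ih' => exact (ih F).trans (ih' F)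

/-- The iterated partial derivative along a multiset of coordinates. -/
def multiPd {ι : Type} [Fintype ι] (s : Multiset ι) : T.Fn ι →ₗ[𝕜] T.Fn ι := T.iterPd s.toList

theorem iterPd_eq_multiPd {ι : Type} [Fintype ι] (l : List ι) :
    T.iterPd l = T.multiPd (l : Multiset ι) :=
  T.iterPd_perm (Multiset.coe_eq_coe.1 (Multiset.coe_toList _)).symm

theorem pd_iterPd {ι : Type} [Fintype ι] (i : ι) (l : List ι) (F : T.Fn ι) :
    T.pd i (T.iterPd l F) = T.iterPd (i :: l) F := by
  induction l generalizing F with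
  | nil => rfl
  | cons a l ih =>
    change T.pd i (T.iterPd l (T.pd a F)) = T.iterPd l (T.pd a (T.pd i F))
    rw [ih, T.pd_comm a i]
    rfl

theorem pd_multiPd {ι : Type} [Fintype ι] (i : ι) (s : Multiset ι) (F : T.Fn ι) :
    T.pd i (T.multiPd s F) = T.multiPd ({i} + s) F := by
  rw [multiPd, pd_iterPd, iterPd_eq_multiPd]
  congr 2
  rw [← Multiset.cons_coe, Multiset.coe_toList, Multiset.singleton_add]

variable {T}

theorem ChainRule.pd_pull_injective (hT : T.ChainRule) {ι κ : Type} [Fintype ι] [Fintype κ]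
    (f : ι → κ) (hf : Function.Injective f) (a : ι) (F : T.Fn ι) :
    T.pd (f a) (T.pull f F) = T.pull f (T.pd a F) := by
  classical
  rw [hT, Finset.sum_eq_single a]
  · simp
  · intro b _ hb
    rw [if_neg fun h => hb (hf h)]
  · simp

theorem ChainRule.multiPd_map_pull (hT : T.ChainRule) {ι κ : Type} [Fintype ι] [Fintype κ]
    (f : ι → κ) (hf : Function.Injective f) (s : Multiset ι) (F : T.Fn ι) :
    T.multiPd (s.map f) (T.pull f F) = T.pull f (T.multiPd s F) := by
  induction s using Quot.inductionOn with
  | h l =>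
    change T.multiPd (Multiset.map f (l : Multiset ι)) (T.pull f F) =
      T.pull f (T.multiPd (l : Multiset ι) F)
    rw [Multiset.map_coe, ← iterPd_eq_multiPd, ← iterPd_eq_multiPd]
    induction l generalizing F with
    | nil => rfl
    | cons a l ih =>
      change T.iterPd (l.map f) (T.pd (f a) (T.pull f F)) = T.pull f (T.iterPd l (T.pd a F))
      rw [hT.pd_pull_injective f hf, ih]

theorem ChainRule.pd_pull_snd (hT : T.ChainRule) {d n : ℕ} (i : Fin d) (F : T.PreChain d n) :
    T.pd i (T.pull Prod.snd F) = ∑ l, T.pull Prod.snd (T.pd (l, i) F) := by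
  classical
  rw [hT, Fintype.sum_prod_type]
  refine Finset.sum_congr rfl fun l _ => ?_
  rw [Finset.sum_eq_single i]
  · simp
  · intro j _ hj
    simp [hj]
  · simp

end FunctionAlgebras

theorem derivation_prod {R A ι : Type*} [CommRing R] [CommRing A] [Algebra R A] [DecidableEq ι]
    (D : Derivation R A A) (s : Finset ι) (X : ι → A) :
    D (∏ i ∈ s, X i) = ∑ j ∈ s, ∏ i ∈ s, if i = j then D (X i) else X i := by
  induction s using Finset.induction_on with
  | empty => simp
  | insert a s ha ih =>
    rw [Finset.prod_insert ha, Finset.sum_insert ha, D.leibniz, ih, Finset.prod_insert ha,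
      if_pos rfl, add_comm, smul_eq_mul, smul_eq_mul, Finset.mul_sum, mul_comm]
    congr 1
    · congr 1
      refine Finset.prod_congr rfl fun i hi => ?_
      rw [if_neg (ne_of_mem_of_not_mem hi ha)]
    · refine Finset.sum_congr rfl fun j hj => ?_
      rw [Finset.prod_insert ha, if_neg (ne_of_mem_of_not_mem hj ha).symm]

namespace Graph

variable {m n p d : ℕ} {k : Fin m → ℕ} {𝕜 : Type u} [Field 𝕜] {T : FunctionAlgebras 𝕜}

/-! ### Polydifferential operators of arbitrary edge lists -/

/-- The labels of the edges that end at `v`, where the edges are given by their end points `c`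
(central edges) and `s` (edges starting at the other type I vertices), not necessarily distinct. -/
def labels (c : Fin p → Vertex m n) (s : ∀ j, Fin (k j) → Vertex m n) (I₀ : Fin p → Fin d)
    (I : ∀ j, Fin (k j) → Fin d) (v : Vertex m n) : Multiset (Fin d) :=
  (∑ e, if c e = v then {I₀ e} else 0) + ∑ j, ∑ e, if s j e = v then {I j e} else 0

/-- The labels of the edges that end at type II vertices. -/
def labelsII (c : Fin p → Vertex m n) (s : ∀ j, Fin (k j) → Vertex m n) (I₀ : Fin p → Fin d)
    (I : ∀ j, Fin (k j) → Fin d) : Multiset (Fin (n + 1) × Fin d) :=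
  ∑ l, (labels c s I₀ I (Sum.inr l)).map fun i => (l, i)

variable (T) in
/-- The summand of the polydifferential operator for a labelling of the edges. -/
def term (c : Fin p → Vertex m n) (s : ∀ j, Fin (k j) → Vertex m n)
    (γ : ∀ j, T.Polyvector d (k j)) (I₀ : Fin p → Fin d) (I : ∀ j, Fin (k j) → Fin d)
    (F : T.PreChain d n) : T.Fn (Fin d) :=
  (∏ j, T.multiPd (labels c s I₀ I (Sum.inl j)) (γ j fun e => Pi.single (I j e) 1)) *
    T.pull Prod.snd (T.multiPd (labelsII c s I₀ I) F)

variable (T) in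
/-- The value on `v₁ ∧ ⋯ ∧ v_p` of the polydifferential operator of a list of edges. -/
def edgeOperator (c : Fin p → Vertex m n) (s : ∀ j, Fin (k j) → Vertex m n)
    (γ : ∀ j, T.Polyvector d (k j)) (F : T.PreChain d n) (v : Fin p → Fin d → 𝕜) : T.Fn (Fin d) :=
  ∑ I₀ : Fin p → Fin d, ∑ I : ∀ j, Fin (k j) → Fin d,
    (Matrix.of fun a b => v a (I₀ b)).det • term T c s γ I₀ I F

theorem coe_map_filter {α β : Type*} (q : α → Prop) [DecidablePred q] (f : α → β) (l : List α) :
    (((l.filter fun e => q e).map f : List β) : Multiset β) =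
      (l.map fun e => if q e then ({f e} : Multiset β) else 0).sum := by
  induction l with
  | nil => rfl
  | cons a l ih =>
    by_cases h : q a
    · simp only [List.filter_cons, h, decide_true, if_true, List.map_cons, List.sum_cons, ← ih]
      rfl
    · simp [h, ← ih]

theorem coe_flatMap {α β : Type*} (g : α → List β) (l : List α) :
    ((l.flatMap g : List β) : Multiset β) = (l.map fun a => (g a : Multiset β)).sum := by
  induction l with
  | nil => rfl
  | cons a l ih => simp [List.flatMap_cons, ← ih]

theorem coe_incoming (Γ : Graph m n p k) (I₀ : Fin p → Fin d) (I : ∀ j, Fin (k j) → Fin d)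
    (v : Vertex m n) : (Γ.incoming I₀ I v : Multiset (Fin d)) = labels Γ.1.1 Γ.1.2 I₀ I v := by
  simp only [incoming, labels, Fin.sum_univ_def, ← coe_map_filter, ← Multiset.coe_add, coe_flatMap]
  rfl

theorem coe_incomingII (Γ : Graph m n p k) (I₀ : Fin p → Fin d) (I : ∀ j, Fin (k j) → Fin d) :
    (Γ.incomingII I₀ I : Multiset (Fin (n + 1) × Fin d)) = labelsII Γ.1.1 Γ.1.2 I₀ I := by
  simp only [incomingII, labelsII, Fin.sum_univ_def, coe_flatMap, ← Multiset.map_coe, coe_incoming]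

theorem operator_apply_eq (Γ : Graph m n p k) (γ : ∀ j, T.Polyvector d (k j)) (F : T.PreChain d n)
    (v : Fin p → Fin d → 𝕜) : Γ.operator T γ F v = edgeOperator T Γ.1.1 Γ.1.2 γ F v := by
  rw [operator_apply]
  refine Finset.sum_congr rfl fun I₀ _ => Finset.sum_congr rfl fun I _ => ?_
  congr 1
  simp only [labelled, term, T.iterPd_eq_multiPd, coe_incoming, coe_incomingII]
  rfl

theorem labels_cons (c : Fin p → Vertex m n) (s : ∀ j, Fin (k j) → Vertex m n)
    (I₀ : Fin p → Fin d) (I : ∀ j, Fin (k j) → Fin d) (K : Vertex m n) (i : Fin d)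
    (v : Vertex m n) : labels (Fin.cons K c : Fin (p + 1) → Vertex m n) s (Fin.cons i I₀) I v =
      (if K = v then {i} else 0) + labels c s I₀ I v := by
  simp [labels, Fin.sum_univ_succ, add_assoc]

theorem labelsII_cons (c : Fin p → Vertex m n) (s : ∀ j, Fin (k j) → Vertex m n)
    (I₀ : Fin p → Fin d) (I : ∀ j, Fin (k j) → Fin d) (K : Vertex m n) (i : Fin d) :
    labelsII (Fin.cons K c : Fin (p + 1) → Vertex m n) s (Fin.cons i I₀) I =
      (∑ l, if K = Sum.inr l then {(l, i)} else 0) + labelsII c s I₀ I := by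
  simp only [labelsII, labels_cons, Multiset.map_add, Finset.sum_add_distrib]
  congr 1
  refine Finset.sum_congr rfl fun l _ => ?_
  split_ifs <;> simp

/-- The Leibniz rule: a derivative of the operator is the sum over all end points of a new central
edge. -/
theorem pd_term (hT : T.ChainRule) (c : Fin p → Vertex m n) (s : ∀ j, Fin (k j) → Vertex m n)
    (γ : ∀ j, T.Polyvector d (k j)) (I₀ : Fin p → Fin d) (I : ∀ j, Fin (k j) → Fin d)
    (F : T.PreChain d n) (i : Fin d) : T.pd i (term T c s γ I₀ I F) =
      ∑ K : Vertex m n, term T (Fin.cons K c : Fin (p + 1) → Vertex m n) s γ (Fin.cons i I₀) I F := by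
  rw [term, Derivation.leibniz, derivation_prod, hT.pd_pull_snd, Fintype.sum_sum_type, add_comm,
    smul_eq_mul, smul_eq_mul, mul_comm, Finset.sum_mul, Finset.mul_sum]
  congr 1
  · refine Finset.sum_congr rfl fun j _ => ?_
    simp only [term, labelsII_cons, labels_cons]
    congr 1
    · refine Finset.prod_congr rfl fun i' _ => ?_
      by_cases h : i' = j
      · subst h
        simp [T.pd_multiPd]
      · have h' : ¬ (Sum.inl j : Vertex m n) = Sum.inl i' := fun e => h (Sum.inl.inj e).symm
        simp [h, h']
    · simp
  · refine Finset.sum_congr rfl fun l _ => ?_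
    simp only [term, labelsII_cons, labels_cons]
    congr 1
    · simp
    · rw [T.pd_multiPd, Finset.sum_eq_single l]
      · simp
      · intro l' _ hl'
        rw [if_neg fun e => hl' (Sum.inr.inj e).symm]
      · simp

theorem dForm_operator (hT : T.ChainRule) (Γ : Graph m n p k) (γ : ∀ j, T.Polyvector d (k j))
    (F : T.PreChain d n) (v : Fin (p + 1) → Fin d → 𝕜) : T.dForm (Γ.operator T γ F) v =
      ∑ K : Vertex m n,
        edgeOperator T (Fin.cons K Γ.1.1 : Fin (p + 1) → Vertex m n) Γ.1.2 γ F v := by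
  have h1 : ∀ K : Vertex m n,
      edgeOperator T (Fin.cons K Γ.1.1 : Fin (p + 1) → Vertex m n) Γ.1.2 γ F v =
      ∑ a : Fin (p + 1), (-1 : 𝕜) ^ (a : ℕ) • ∑ i, v a i • ∑ I₀ : Fin p → Fin d,
        ∑ I : ∀ j, Fin (k j) → Fin d, (Matrix.of fun a' b => v (a.succAbove a') (I₀ b)).det •
          term T (Fin.cons K Γ.1.1 : Fin (p + 1) → Vertex m n) Γ.1.2 γ (Fin.cons i I₀) I F := by
    intro K
    rw [edgeOperator, ← (Fin.consEquiv fun _ => Fin d).sum_comp, Fintype.sum_prod_type]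
    have h : ∀ (i : Fin d) (I₀ : Fin p → Fin d), (Matrix.of fun a b => v a (Fin.consEquiv
        (fun _ => Fin d) (i, I₀) b)).det = ∑ a : Fin (p + 1), (-1) ^ (a : ℕ) *
          (v a i * (Matrix.of fun a' b => v (a.succAbove a') (I₀ b)).det) := fun i I₀ => by
      rw [Matrix.det_succ_column_zero]
      refine Finset.sum_congr rfl fun a _ => ?_
      rw [mul_assoc]
      rfl
    simp only [h, Finset.sum_smul, Finset.smul_sum, smul_smul]
    exact Eq.trans (Finset.sum_congr rfl fun i _ => Eq.trans (Finset.sum_congr rfl fun I₀ _ =>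
      Finset.sum_comm) Finset.sum_comm) Finset.sum_comm
  simp only [h1]
  rw [Finset.sum_comm, FunctionAlgebras.dForm, AlternatingMap.alternatizeUncurryFin_apply]
  refine Finset.sum_congr rfl fun a _ => ?_
  rw [← Finset.smul_sum]
  have h2 : ∀ x : T.Fn (Fin d), (-1 : ℤ) ^ (a : ℕ) • x = (-1 : 𝕜) ^ (a : ℕ) • x := fun x => by
    rcases Nat.even_or_odd (a : ℕ) with h | h <;> simp [h.neg_one_pow]
  have h3 : ∀ x : T.Fn (Fin d), T.dirDeriv d (v a) x = ∑ i, v a i • T.pd i x := fun x => by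
    simp [FunctionAlgebras.dirDeriv]
  refine Eq.trans (h2 (T.dirDeriv d (v a) (Γ.operator T γ F (a.removeNth v)))) ?_
  rw [h3, operator_apply_eq, Finset.sum_comm]
  congr 1
  refine Finset.sum_congr rfl fun i _ => ?_
  rw [← Finset.smul_sum]
  congr 1
  simp only [edgeOperator, map_sum, Derivation.map_smul, pd_term hT, Finset.smul_sum]
  exact Eq.trans (Finset.sum_congr rfl fun I₀ _ => Finset.sum_comm) Finset.sum_comm

theorem edgeOperator_comp_perm (c : Fin p → Vertex m n) (s : ∀ j, Fin (k j) → Vertex m n)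
    (γ : ∀ j, T.Polyvector d (k j)) (F : T.PreChain d n) (v : Fin p → Fin d → 𝕜)
    (σ : Equiv.Perm (Fin p)) :
    edgeOperator T (c ∘ σ) s γ F v = ((Equiv.Perm.sign σ : ℤ) : 𝕜) • edgeOperator T c s γ F v := by
  rw [edgeOperator, ← (σ.symm.arrowCongr (Equiv.refl (Fin d))).sum_comp, edgeOperator,
    Finset.smul_sum]
  refine Finset.sum_congr rfl fun I₀ _ => ?_
  rw [Finset.smul_sum]
  refine Finset.sum_congr rfl fun I _ => ?_
  have h1 : ∀ v, labels (c ∘ σ) s ((σ.symm.arrowCongr (Equiv.refl (Fin d))) I₀) I v =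
      labels c s I₀ I v := fun v => by
    simp only [labels]
    rw [← Equiv.sum_comp σ fun e => if c e = v then {I₀ e} else 0]
    simp
  have h2 := Matrix.det_permute' σ (Matrix.of fun a b => v a (I₀ b))
  rw [smul_smul, ← h2]
  simp only [term, labelsII, h1]
  rfl

theorem edgeOperator_eq_zero [CharZero 𝕜] (c : Fin p → Vertex m n)
    (s : ∀ j, Fin (k j) → Vertex m n) (γ : ∀ j, T.Polyvector d (k j)) (F : T.PreChain d n)
    (v : Fin p → Fin d → 𝕜) (hc : ¬ Function.Injective c) : edgeOperator T c s γ F v = 0 := by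
  simp only [Function.Injective, not_forall] at hc
  obtain ⟨a, b, hab, hne⟩ := hc
  have h := edgeOperator_comp_perm (T := T) c s γ F v (Equiv.swap a b)
  have hcomp : c ∘ Equiv.swap a b = c := by
    funext e
    simp only [Function.comp, Equiv.swap_apply_def]
    split_ifs with h1 h2
    · rw [h1, hab]
    · rw [h2, hab]
    · rfl
  rw [hcomp, Equiv.Perm.sign_swap hne] at h
  have h2 : (2 : 𝕜) • edgeOperator T c s γ F v = 0 := by
    rw [two_smul]
    nth_rewrite 1 [h]
    simp
  exact (smul_eq_zero.1 h2).resolve_left two_ne_zero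

/-! ### Operators of rotated graphs -/

theorem cyc_injective (d : ℕ) (t : Fin (n + 1)) : Function.Injective (FunctionAlgebras.cyc d t) := by
  rintro ⟨a, i⟩ ⟨b, j⟩ h
  simpa [FunctionAlgebras.cyc, Prod.ext_iff] using h

theorem rotVertex_ne (t : Fin (n + 1)) (v : Vertex m n) : rotVertex t v ≠ Sum.inr 0 := by
  rcases v with j | s
  · simp [rotVertex]
  · simp [rotVertex, Fin.succ_ne_zero]

theorem labels_rotVertex (c : Fin p → Vertex m n) (s : ∀ j, Fin (k j) → Vertex m n)
    (I₀ : Fin p → Fin d) (I : ∀ j, Fin (k j) → Fin d) (t : Fin (n + 1)) (v : Vertex m n) :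
    labels (fun e => rotVertex t (c e)) (fun j e => rotVertex t (s j e)) I₀ I (rotVertex t v) =
      labels c s I₀ I v := by
  simp only [labels, (rotVertex_injective t).eq_iff]

theorem labels_rotVertex_zero (c : Fin p → Vertex m n) (s : ∀ j, Fin (k j) → Vertex m n)
    (I₀ : Fin p → Fin d) (I : ∀ j, Fin (k j) → Fin d) (t : Fin (n + 1)) :
    labels (fun e => rotVertex t (c e)) (fun j e => rotVertex t (s j e)) I₀ I (Sum.inr 0) = 0 := by
  simp [labels, rotVertex_ne]

theorem labelsII_rotVertex (c : Fin p → Vertex m n) (s : ∀ j, Fin (k j) → Vertex m n)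
    (I₀ : Fin p → Fin d) (I : ∀ j, Fin (k j) → Fin d) (t : Fin (n + 1)) :
    labelsII (fun e => rotVertex t (c e)) (fun j e => rotVertex t (s j e)) I₀ I =
      (labelsII c s I₀ I).map (FunctionAlgebras.cyc d t) := by
  rw [labelsII, Fin.sum_univ_succ, labels_rotVertex_zero, Multiset.map_zero, zero_add, labelsII,
    ← Multiset.coe_mapAddMonoidHom, map_sum, ← (Equiv.subRight t).sum_comp]
  refine Finset.sum_congr rfl fun l _ => ?_
  have h : (Sum.inr (Equiv.subRight t l).succ : Vertex m (n + 1)) = rotVertex t (Sum.inr l) := rfl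
  rw [h, labels_rotVertex, Multiset.coe_mapAddMonoidHom, Multiset.map_map]
  rfl

theorem operator_rotate (hT : T.ChainRule) (Γ : Graph m n p k) (γ : ∀ j, T.Polyvector d (k j))
    (F : T.PreChain d n) (t : Fin (n + 1)) :
    (Γ.rotate t).operator T γ (T.pull (FunctionAlgebras.cyc d t) F) = Γ.operator T γ F := by
  ext v
  rw [operator_apply_eq, operator_apply_eq]
  refine Finset.sum_congr rfl fun I₀ _ => Finset.sum_congr rfl fun I _ => ?_
  congr 1
  simp only [term, rotate]
  rw [labelsII_rotVertex, hT.multiPd_map_pull _ (cyc_injective d t), T.pull_pull]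
  congr 1
  refine Finset.prod_congr rfl fun j _ => ?_
  rw [← labels_rotVertex (c := Γ.1.1) (t := t)]
  rfl

/-- Graphs with an edge that ends at `0̄` do not contribute on chains whose factor `a₀` is `1`. -/
theorem operator_cyc_eq_zero (Γ : Graph m (n + 1) p k) (γ : ∀ j, T.Polyvector d (k j))
    (F : T.PreChain d n) (t : Fin (n + 1)) (e : Edge p k) (he : Γ.target e = Sum.inr 0) :
    Γ.operator T γ (T.pull (FunctionAlgebras.cyc d t) F) = 0 := by
  ext v
  rw [operator_apply]
  refine Finset.sum_eq_zero fun I₀ _ => Finset.sum_eq_zero fun I _ => ?_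
  obtain ⟨i, hi⟩ : ∃ i, i ∈ Γ.incoming I₀ I (Sum.inr 0) := by
    rcases e with e | ⟨l, e⟩
    · refine ⟨I₀ e, List.mem_append_left _ (List.mem_map_of_mem ?_)⟩
      exact List.mem_filter.2 ⟨List.mem_finRange e, by simpa [target] using he⟩
    · refine ⟨I l e, List.mem_append_right _ (List.mem_flatMap.2 ⟨l, List.mem_finRange l,
        List.mem_map_of_mem ?_⟩)⟩
      exact List.mem_filter.2 ⟨List.mem_finRange e, by simpa [target] using he⟩
  have hmem : ((0 : Fin (n + 2)), i) ∈ Γ.incomingII I₀ I :=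
    List.mem_flatMap.2 ⟨0, List.mem_finRange _, List.mem_map_of_mem hi⟩
  have hz : T.iterPd (Γ.incomingII I₀ I) (T.pull (FunctionAlgebras.cyc d t) F) = 0 := by
    refine T.iterPd_eq_zero _ _ (T.pd_pull_of_notMem _ _ _ ?_) _ hmem
    rintro ⟨a, ha⟩
    exact Fin.succ_ne_zero (a.1 - t) (congrArg Prod.fst ha)
  simp [labelled, hz]

theorem exists_rotate_eq (Γ : Graph m (n + 1) p k) (t : Fin (n + 1))
    (hΓ : ∀ e, Γ.target e ≠ Sum.inr 0) : ∃ Γ' : Graph m n p k, Γ'.rotate t = Γ := by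
  have hsurj : ∀ v : Vertex m (n + 1), v ≠ Sum.inr 0 → ∃ u : Vertex m n, rotVertex t u = v := by
    rintro (j | l) hl
    · exact ⟨Sum.inl j, rfl⟩
    · obtain ⟨s, rfl⟩ := Fin.exists_succ_eq.2 fun h : l = 0 => hl (congrArg Sum.inr h)
      exact ⟨Sum.inr (s + t), by simp [rotVertex]⟩
  choose c hc using fun e => hsurj (Γ.center e) (hΓ (Sum.inl e))
  choose s hs using fun j e => hsurj (Γ.star j e) (hΓ (Sum.inr ⟨j, e⟩))
  refine ⟨⟨(c, s), ?_, fun j => ⟨?_, fun e h => ?_⟩⟩, ?_⟩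
  · intro a b hab
    exact Γ.2.1 ((hc a).symm.trans ((congrArg (rotVertex t) hab).trans (hc b)))
  · intro a b hab
    exact (Γ.2.2 j).1 ((hs j a).symm.trans ((congrArg (rotVertex t) hab).trans (hs j b)))
  · exact (Γ.2.2 j).2 e ((hs j e).symm.trans (congrArg (rotVertex t) h))
  · exact Subtype.ext (Prod.ext (funext hc) (funext fun j => funext (hs j)))

end Graph

namespace Graph

variable {m n p d : ℕ} {k : Fin m → ℕ}

/-! ### Comparison of the two sides -/

/-- Reordering the central edges. -/
def permute (Γ : Graph m n p k) (σ : Equiv.Perm (Fin p)) : Graph m n p k :=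
  ⟨(Γ.1.1 ∘ σ, Γ.1.2), Γ.2.1.comp σ.injective, Γ.2.2⟩

/-- Reordering the central edges, as an equivalence. -/
def permuteEquiv (m n : ℕ) (k : Fin m → ℕ) (σ : Equiv.Perm (Fin p)) :
    Graph m n p k ≃ Graph m n p k where
  toFun Γ := Γ.permute σ
  invFun Γ := Γ.permute σ.symm
  left_inv Γ := Subtype.ext (Prod.ext (funext fun e => by simp [permute]) rfl)
  right_inv Γ := Subtype.ext (Prod.ext (funext fun e => by simp [permute]) rfl)

theorem erase_permute_cycleRange (Γ : Graph m n (p + 1) k) (e : Fin (p + 1)) :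
    (Γ.permute e.cycleRange).erase e = Γ.erase 0 := by
  refine Subtype.ext (Prod.ext (funext fun a => ?_) rfl)
  simp [permute, erase, Fin.cycleRange_succAbove]

variable {𝕜 : Type u} [RCLike 𝕜] {T : FunctionAlgebras 𝕜}

/-- On the left side, only the rotated graphs contribute. -/
theorem sum_weight_cyc (hT : T.ChainRule) (γ : ∀ j, T.Polyvector d (k j)) (F : T.PreChain d n)
    (t : Fin (n + 1)) : ∑ Γ : Graph m (n + 1) p k,
      (Γ.weight : 𝕜) • Γ.operator T γ (T.pull (FunctionAlgebras.cyc d t) F) =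
    ∑ Γ : Graph m n p k, ((Γ.rotate t).weight : 𝕜) • Γ.operator T γ F := by
  symm
  refine Fintype.sum_of_injective (fun Γ => Γ.rotate t) (fun Γ Γ' h => ?_) _ _ (fun Γ hΓ => ?_)
    fun Γ => ?_
  · refine Subtype.ext (Prod.ext (funext fun e => ?_) (funext fun j => funext fun e => ?_))
    · exact rotVertex_injective t (congrFun (congrArg (fun G => G.1.1) h) e)
    · exact rotVertex_injective t (congrFun (congrFun (congrArg (fun G => G.1.2) h) j) e)
  · by_cases h : ∃ e, Γ.target e = Sum.inr 0
    · obtain ⟨e, he⟩ := h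
      rw [operator_cyc_eq_zero Γ γ F t e he, smul_zero]
    · obtain ⟨Γ', rfl⟩ := exists_rotate_eq Γ t (not_exists.1 h)
      exact absurd ⟨Γ', rfl⟩ hΓ
  · simp only [operator_rotate hT]

/-- On the right side, the de Rham differential adds a central edge. -/
theorem sum_weight_dForm (hT : T.ChainRule) (γ : ∀ j, T.Polyvector d (k j)) (F : T.PreChain d n)
    (v : Fin (p + 1) → Fin d → 𝕜) :
    ∑ Γ : Graph m n p k, (Γ.weight : 𝕜) • T.dForm (Γ.operator T γ F) v =
      ∑ Γ : Graph m n (p + 1) k, ((Γ.erase 0).weight : 𝕜) • Γ.operator T γ F v := by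
  simp only [dForm_operator hT, Finset.smul_sum]
  rw [← Fintype.sum_prod_type']
  symm
  refine Fintype.sum_of_injective (fun Γ : Graph m n (p + 1) k => (Γ.erase 0, Γ.1.1 0))
    (fun Γ Γ' h => ?_) _ _ (fun ⟨Γ, K⟩ hΓ => ?_) fun Γ => ?_
  · obtain ⟨h1, h2⟩ := Prod.mk.inj h
    refine Subtype.ext (Prod.ext (funext fun e => ?_) (congrArg (fun G => G.1.2) h1))
    induction e using Fin.cases with
    | zero => exact h2
    | succ e => exact congrFun (congrArg (fun G => G.1.1) h1) e
  · simp only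
    rw [edgeOperator_eq_zero, smul_zero]
    intro hinj
    exact hΓ ⟨⟨(Fin.cons K Γ.1.1, Γ.1.2), hinj, Γ.2.2⟩, rfl⟩
  · simp only
    rw [operator_apply_eq]
    congr 2
    funext e
    induction e using Fin.cases <;> rfl

/-- By the antisymmetry in the central edges, it does not matter which central edge is removed. -/
theorem sum_integral_erase (γ : ∀ j, T.Polyvector d (k j)) (F : T.PreChain d n)
    (v : Fin (p + 1) → Fin d → 𝕜) (e : Fin (p + 1)) :
    ∑ Γ : Graph m n (p + 1) k,
      (((-1) ^ (e : ℕ) * (Γ.erase e).integral : ℝ) : 𝕜) • Γ.operator T γ F v =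
    ∑ Γ : Graph m n (p + 1) k, ((Γ.erase 0).integral : 𝕜) • Γ.operator T γ F v := by
  rw [← (permuteEquiv m n k e.cycleRange).sum_comp]
  refine Finset.sum_congr rfl fun Γ _ => ?_
  change (((-1) ^ (e : ℕ) * ((Γ.permute e.cycleRange).erase e).integral : ℝ) : 𝕜) •
    (Γ.permute e.cycleRange).operator T γ F v = _
  rw [erase_permute_cycleRange, operator_apply_eq, operator_apply_eq]
  refine Eq.trans (congrArg _ (edgeOperator_comp_perm Γ.1.1 Γ.1.2 γ F v e.cycleRange)) ?_
  rw [smul_smul, Fin.sign_cycleRange]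
  congr 1
  rcases Nat.even_or_odd (e : ℕ) with h | h <;> simp [h.neg_one_pow]

end Graph

variable {𝕜 : Type u} [RCLike 𝕜] {T : FunctionAlgebras 𝕜} {d m n : ℕ} {k : Fin m → ℕ}

theorem morphism_connes (hT : T.ChainRule) (γ : ∀ j, T.Polyvector d (k j)) (c : T.Chain d n) :
    morphism T γ (T.connes d n c) = T.deRham (morphism T γ c) := by
  obtain ⟨F, rfl⟩ := Submodule.Quotient.mk_surjective _ c
  change preMorphism T γ (T.preConnes d n F) = T.deRham (preMorphism T γ F)
  have hL : ∀ q, preMorphism T γ (T.preConnes d n F) q = ∑ t : Fin (n + 1),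
      ((-1 : 𝕜) ^ (n * (t : ℕ))) •
        ∑ Γ : Graph m n q k, ((Γ.rotate t).weight : 𝕜) • Γ.operator T γ F := by
    intro q
    simp only [FunctionAlgebras.preConnes, LinearMap.sum_apply, LinearMap.smul_apply, map_sum,
      map_smul, Finset.sum_apply, Pi.smul_apply]
    refine Finset.sum_congr rfl fun t _ => ?_
    rw [← Graph.sum_weight_cyc hT]
    rfl
  funext q
  rw [hL]
  cases q with
  | zero =>
    refine Finset.sum_eq_zero fun t _ => ?_
    rw [Finset.sum_eq_zero fun Γ _ => ?_, smul_zero]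
    rw [Graph.weight, Graph.integral_rotate_eq_zero]
    simp
  | succ p =>
    ext v
    have hR : T.deRham (preMorphism T γ F) (p + 1) v =
        ∑ Γ : Graph m n p k, (Γ.weight : 𝕜) • T.dForm (Γ.operator T γ F) v := by
      change T.dForm (∑ Γ : Graph m n p k, (Γ.weight : 𝕜) • Γ.operator T γ F) v = _
      simp only [FunctionAlgebras.dForm, AlternatingMap.alternatizeUncurryFin_apply,
        Finset.smul_sum]
      rw [Finset.sum_comm]
      refine Finset.sum_congr rfl fun a _ => ?_
      change (-1 : ℤ) ^ (a : ℕ) • T.dirDeriv d (v a) ((∑ Γ : Graph m n p k,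
        (Γ.weight : 𝕜) • Γ.operator T γ F) (a.removeNth v)) = _
      rw [Graph.sum_apply, map_sum, Finset.smul_sum]
      refine Finset.sum_congr rfl fun Γ _ => ?_
      rw [AlternatingMap.smul_apply, map_smul, smul_comm]
      rfl
    rw [hR, Graph.sum_weight_dForm hT]
    have hw : ∀ Γ : Graph m n (p + 1) k, ∑ t : Fin (n + 1),
        (-1 : 𝕜) ^ (n * (t : ℕ)) * ((Γ.rotate t).weight : 𝕜) =
        ((((p + 1).factorial : ℝ)⁻¹ * ∏ j, ((k j).factorial : ℝ)⁻¹ : ℝ) : 𝕜) *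
          ∑ e : Fin (p + 1), (((-1) ^ (e : ℕ) * (Γ.erase e).integral : ℝ) : 𝕜) := by
      intro Γ
      have h := congrArg (fun x : ℝ => (((((p + 1).factorial : ℝ)⁻¹ *
        ∏ j, ((k j).factorial : ℝ)⁻¹ : ℝ)) : 𝕜) * (x : 𝕜)) Γ.sum_integral_rotate
      simp only [Graph.weight]
      push_cast at h ⊢
      rw [← h, Finset.mul_sum]
      refine Finset.sum_congr rfl fun t _ => ?_
      ring
    simp only [Graph.sum_apply, AlternatingMap.smul_apply, Finset.smul_sum, smul_smul]
    rw [Finset.sum_comm]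
    simp only [← Finset.sum_smul, hw]
    simp only [mul_smul, Finset.sum_smul]
    rw [← Finset.smul_sum, Finset.sum_comm]
    simp only [Graph.sum_integral_erase, Finset.sum_const, Finset.card_univ, Fintype.card_fin]
    rw [← Nat.cast_smul_eq_nsmul 𝕜, smul_smul, Finset.smul_sum]
    refine Finset.sum_congr rfl fun Γ _ => ?_
    rw [smul_smul]
    congr 1
    simp only [Graph.weight, Nat.factorial_succ]
    push_cast
    have h1 : ((p : 𝕜) + 1) ≠ 0 := Nat.cast_add_one_ne_zero p
    field_simp

end Shoikhet

end

theorem theorem3 {𝕜 : Type*} [RCLike 𝕜] (d m n : ℕ) (k : Fin m → ℕ) :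
    (∀ (γ : ∀ j, (Shoikhet.smooth 𝕜).Polyvector d (k j)) (c : (Shoikhet.smooth 𝕜).Chain d n),
      Shoikhet.morphism (Shoikhet.smooth 𝕜) γ ((Shoikhet.smooth 𝕜).connes d n c) =
        (Shoikhet.smooth 𝕜).deRham (Shoikhet.morphism (Shoikhet.smooth 𝕜) γ c)) ∧
    (∀ (γ : ∀ j, (Shoikhet.formal 𝕜).Polyvector d (k j)) (c : (Shoikhet.formal 𝕜).Chain d n),
      Shoikhet.morphism (Shoikhet.formal 𝕜) γ ((Shoikhet.formal 𝕜).connes d n c) =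
        (Shoikhet.formal 𝕜).deRham (Shoikhet.morphism (Shoikhet.formal 𝕜) γ c)) :=
  ⟨Shoikhet.morphism_connes (Shoikhet.chainRule_smooth 𝕜),
    Shoikhet.morphism_connes (Shoikhet.chainRule_formal 𝕜)⟩
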